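/- Let $p\in(0,1]$ and $s>\frac12$, and for $t\in\mathbb{R}$ let $$\mathrm{Cl}_{p;s}(t)=\prod_{n=1}^\infty\left[1-p+p\cos\left(t/n^s\right)\right],\qquad C_{p;s}=-\frac1s\int_0^\infty \ln\left|1-p+p\cos\xi\right|\,\frac{1}{\xi^{1+1/s}}\,d\xi ,$$ where the product converges unconditionally for every $t$ and the integral converges absolutely. Then there are a function $F_{p;s}:[0,\infty)\to\mathbb{R}$ and a constant $K_{p;s}>0$ (depending only on $p$ and $s$) such that, for all $t\in\mathbb{R}$, $$\mathrm{Cl}_{p;s}(t)=\exp\left(-C_{p;s}|t|^{1/s}\right)F_{p;s}(|t|),\qquad |F_{p;s}(|t|)|\le \exp\left(K_{p;s}|t|^{1/(s+1)}\right).$$ Moreover, when $p\in(0,\frac12)$, one has $F_{p;s}(|t|)>0$ and the stronger bound $|\ln F_{p;s}(|t|)|\le K_{p;s}|t|^{1/(s+1)}$ for all $t\in\mathbb{R}$, and furthermore $C_{p;s}=A_sB_{p;s}$, where $$A_s=\int_0^\infty \frac{\sin\xi}{\xi^{1/s}}\,d\xi=\Gamma\left(1-\tfrac1s\right)\cos\left(\tfrac{\pi}{2s}\right)$$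 is a convergent improper integral $\lim_{R\to\infty}\int_0^R$ (for $s=1$ the right-hand side is understood as the limit $A_1=\lim_{r\to1}\Gamma(1-\frac1r)\cos(\frac{\pi}{2r})=\frac\pi2$), and where $$B_{p;s}=\sum_{n=0}^\infty(-1)^n\left(\frac{p}{1-p}\right)^{n+1}\frac{1}{2^n}\sum_{k=0}^{\lceil (n-1)/2\rceil}\binom{n}{k}\frac{(1+n-2k)^{1/s}}{1+n-k}$$ is an absolutely convergent series. -/

import Mathlib

open Filter Topology MeasureTheory

namespace RandomZeta

/-- The factor `1 - p + p cos (t / n ^ s)` of the trigonometric product. -/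
noncomputable def factor (p s t : ℝ) (n : ℕ) : ℝ :=
  1 - p + p * Real.cos (t / (n : ℝ) ^ s)

/-- The infinite trigonometric product `∏_{n ≥ 1} (1 - p + p cos (t / n ^ s))`. -/
noncomputable def Cl (p s t : ℝ) : ℝ :=
  ∏' n : ℕ, factor p s t (n + 1)

/-- The integrand `ln |1 - p + p cos ξ| · ξ ^ (-(1 + 1 / s))`. -/
noncomputable def integrandC (p s ξ : ℝ) : ℝ :=
  Real.log |1 - p + p * Real.cos ξ| * (1 / ξ ^ (1 + 1 / s))

/-- The trend coefficient `C_{p;s}`. -/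
noncomputable def coeffC (p s : ℝ) : ℝ :=
  -(1 / s) * ∫ ξ in Set.Ioi (0 : ℝ), integrandC p s ξ

/-- The integrand `sin ξ · ξ ^ (-1 / s)`. -/
noncomputable def integrandA (s ξ : ℝ) : ℝ :=
  Real.sin ξ * (1 / ξ ^ (1 / s))

/-- The improper integral `A_s = ∫_0^∞ sin ξ · ξ ^ (-1 / s) dξ`, the limit of `∫_0^R` as `R → ∞`
(for `s ≥ 1` it does not converge absolutely). -/
noncomputable def coeffA (s : ℝ) : ℝ :=
  limUnder atTop (fun R : ℝ => ∫ ξ in (0 : ℝ)..R, integrandA s ξ)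

/-- The `n`-th term of the series for `B_{p;s}`. -/
noncomputable def termB (p s : ℝ) (n : ℕ) : ℝ :=
  (-1) ^ n * (p / (1 - p)) ^ (n + 1) * (1 / 2 ^ n) *
    ∑ k ∈ Finset.range (⌈((n : ℝ) - 1) / 2⌉₊ + 1),
      (n.choose k : ℝ) * ((1 + n - 2 * k : ℝ) ^ (1 / s) / (1 + n - k : ℝ))

/-- The series `B_{p;s}`. -/
noncomputable def coeffB (p s : ℝ) : ℝ :=
  ∑' n : ℕ, termB p s n

end RandomZeta

namespace RandomZeta

/-! Put f(x) = ln |1 - p + p cos x|. When no factor vanishes, ln |Cl(t)| is the sum of f(t / n^s)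
over n ≥ 1. The substitution ξ = t / x^s turns ∫_0^∞ f(t / x^s) dx into exactly -C t^(1/s), so the
fluctuation is the error made in replacing the sum by the integral.

That error is estimated by cutting at N ≈ t^(1/(s+1)), where t / x^s moves by about 1 per unit step.
Below N each term is at most 0 and the integral of -f costs O(N). Above N, the increments of f obey
f(x) - f(y) ≤ |x - y|^(2/3) G(y), where the weight G has integral O(u) over (0, u]; this contributes
O(t^(1/(s+1))) again (`exists_tsum_le_integral_add`). The point y is the integration variable, so a
sample n near a zero of the factor does no harm to this upper bound, though it could spoil a lower
one. For p < 1/2 the factor stays away from 0, G may be constant, and the same comparison applied to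
-f gives the two-sided bound.

For C = A B, expand f in powers of cos, then cos^m in multiple angles. Everything reduces to the
moment of (1 - cos x) x^(-1-a) with a = 1/s, which gamma integrals evaluate and which equals A_s / a
after integration by parts (`hasSum_termB`, `termB_eq`, `coeffA_eq`). -/

/-! ### Moments of 1 - cos -/

theorem setLIntegral_ofReal_of_setIntegral_eq {g : ℝ → ℝ} {c : ℝ}
    (h0 : ∀ x ∈ Set.Ioi (0 : ℝ), 0 ≤ g x) (h : ∫ x in Set.Ioi (0 : ℝ), g x = c) (hc : c ≠ 0) :
    ∫⁻ x in Set.Ioi (0 : ℝ), ENNReal.ofReal (g x) = ENNReal.ofReal c := by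
  rw [← h, ofReal_integral_eq_lintegral_ofReal]
  -- The integral of a non-integrable function is 0 by convention, so a nonzero value certifies
  -- integrability.
  · exact Integrable.of_integral_ne_zero (h ▸ hc)
  · exact (ae_restrict_iff' measurableSet_Ioi).2 (Eventually.of_forall h0)

/-- Write 1 / (1 + u²) as ∫ exp(-(1 + u²) w) dw and apply Tonelli: the u-integral gives Γ(a/2), the
w-integral Γ(1 - a/2), and reflection finishes. -/
theorem lintegral_rpow_div_one_add_sq {a : ℝ} (h0 : 0 < a) (h2 : a < 2) :
    ∫⁻ u in Set.Ioi (0 : ℝ), ENNReal.ofReal (u ^ (a - 1) / (1 + u ^ 2)) =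
      ENNReal.ofReal (Real.pi / (2 * Real.sin (Real.pi * (a / 2)))) := by
  have hG1 : 0 < Real.Gamma (a / 2) := Real.Gamma_pos_of_pos (by linarith)
  have hG2 : 0 < Real.Gamma (1 - a / 2) := Real.Gamma_pos_of_pos (by linarith)
  have e1 : ∀ u ∈ Set.Ioi (0 : ℝ), ENNReal.ofReal (u ^ (a - 1) / (1 + u ^ 2)) =
      ∫⁻ w in Set.Ioi (0 : ℝ), ENNReal.ofReal (u ^ (a - 1) * Real.exp (-(1 + u ^ 2) * w)) := by
    intro u hu
    have hu' : 0 < u := hu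
    symm
    apply setLIntegral_ofReal_of_setIntegral_eq
    · intro x _; positivity
    · rw [integral_const_mul, integral_exp_mul_Ioi (by nlinarith [sq_nonneg u])]
      simp only [mul_zero, Real.exp_zero]
      field_simp
    · positivity
  have e2 : ∀ w ∈ Set.Ioi (0 : ℝ),
      ∫⁻ u in Set.Ioi (0 : ℝ), ENNReal.ofReal (u ^ (a - 1) * Real.exp (-(1 + u ^ 2) * w)) =
      ENNReal.ofReal (Real.Gamma (a / 2) / 2 * (w ^ (1 - a / 2 - 1) * Real.exp (-(1 * w)))) := by
    intro w hw
    have hw' : 0 < w := hw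
    apply setLIntegral_ofReal_of_setIntegral_eq
    · intro x hx
      have : (0 : ℝ) < x := hx
      positivity
    · have := integral_rpow_mul_exp_neg_mul_rpow (p := 2) (q := a - 1) (b := w) two_pos
        (by linarith) hw'
      have h3 : ∀ u : ℝ, u ^ (a - 1) * Real.exp (-(1 + u ^ 2) * w) =
          Real.exp (-(1 * w)) * (u ^ (a - 1) * Real.exp (-w * u ^ (2 : ℝ))) := by
        intro u
        rw [Real.rpow_two, mul_left_comm, ← Real.exp_add]
        congr 2; ring
      simp_rw [h3]
      rw [integral_const_mul, this]
      have e4 : -(a - 1 + 1) / 2 = 1 - a / 2 - 1 := by ring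
      have e5 : (a - 1 + 1) / 2 = a / 2 := by ring
      rw [e4, e5]; ring
    · positivity
  rw [setLIntegral_congr_fun measurableSet_Ioi e1, lintegral_lintegral_swap,
    setLIntegral_congr_fun measurableSet_Ioi e2]
  · apply setLIntegral_ofReal_of_setIntegral_eq
    · intro x hx
      have : (0 : ℝ) < x := hx
      positivity
    · rw [integral_const_mul, Real.integral_rpow_mul_exp_neg_mul_Ioi (by linarith) one_pos,
        div_one, Real.one_rpow, one_mul, div_mul_eq_mul_div, Real.Gamma_mul_Gamma_one_sub,
        div_div, mul_comm (Real.sin _)]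
    · have : 0 < Real.sin (Real.pi * (a / 2)) := by
        apply Real.sin_pos_of_pos_of_lt_pi <;> nlinarith [Real.pi_pos]
      have := Real.pi_pos
      positivity
  · apply Measurable.aemeasurable
    unfold Function.uncurry
    fun_prop

theorem setIntegral_one_sub_cos_mul_exp {u : ℝ} (hu : 0 < u) :
    ∫ x in Set.Ioi (0 : ℝ), (1 - Real.cos x) * Real.exp (-(u * x)) = 1 / (u * (1 + u ^ 2)) := by
  have hd : ∀ x ∈ Set.Ici (0 : ℝ), HasDerivAt
      (fun x => Real.exp (-(u * x)) * (-1 / u + (u * Real.cos x - Real.sin x) / (1 + u ^ 2)))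
      ((1 - Real.cos x) * Real.exp (-(u * x))) x := by
    intro x _
    have h1 : HasDerivAt (fun x => Real.exp (-(u * x))) (Real.exp (-(u * x)) * (-(u * 1))) x :=
      ((hasDerivAt_id x).const_mul u).neg.exp
    have h2 := ((((Real.hasDerivAt_cos x).const_mul u).sub (Real.hasDerivAt_sin x)).div_const
      (1 + u ^ 2)).const_add (-1 / u)
    convert! h1.mul h2 using 1
    simp only [Pi.sub_apply]
    field_simp
    ring
  have hlim : Tendsto (fun x => Real.exp (-(u * x)) *
      (-1 / u + (u * Real.cos x - Real.sin x) / (1 + u ^ 2))) atTop (𝓝 0) := by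
    have h1 : Tendsto (fun x : ℝ => Real.exp (-(u * x))) atTop (𝓝 0) :=
      Real.tendsto_exp_neg_atTop_nhds_zero.comp (tendsto_id.const_mul_atTop hu)
    refine h1.zero_mul_isBoundedUnder_le ?_
    refine ⟨1 / u + (u + 1) / (1 + u ^ 2), ?_⟩
    simp only [eventually_map, Function.comp]
    refine Eventually.of_forall fun x => ?_
    refine (norm_add_le _ _).trans ?_
    rw [norm_div, norm_div, norm_neg, norm_one, Real.norm_of_nonneg hu.le,
      Real.norm_of_nonneg (by positivity : 0 ≤ 1 + u ^ 2)]
    gcongr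
    refine (norm_sub_le _ _).trans ?_
    rw [norm_mul, Real.norm_of_nonneg hu.le]
    have := Real.abs_cos_le_one x
    have := Real.abs_sin_le_one x
    simp only [Real.norm_eq_abs]
    nlinarith
  rw [integral_Ioi_of_hasDerivAt_of_nonneg' hd _ hlim]
  · simp
    field_simp
    ring
  · intro x _
    exact mul_nonneg (sub_nonneg.2 (Real.cos_le_one x)) (Real.exp_pos _).le

/-- The value of `∫_0^∞ (1 - cos x) x ^ (-(1 + a)) dx` for `0 < a < 2`. -/
noncomputable def cosMoment (a : ℝ) : ℝ :=
  Real.pi / (2 * Real.Gamma (a + 1) * Real.sin (Real.pi * (a / 2)))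

theorem sin_half_pos {a : ℝ} (h0 : 0 < a) (h2 : a < 2) : 0 < Real.sin (Real.pi * (a / 2)) := by
  apply Real.sin_pos_of_pos_of_lt_pi <;> nlinarith [Real.pi_pos]

theorem cosMoment_pos {a : ℝ} (h0 : 0 < a) (h2 : a < 2) : 0 < cosMoment a := by
  have h1 := sin_half_pos h0 h2
  have := Real.pi_pos
  have hG : 0 < Real.Gamma (a + 1) := Real.Gamma_pos_of_pos (by linarith)
  unfold cosMoment
  positivity

/-- Write x^(-1-a) as a gamma integral of u^a exp(-xu) and apply Tonelli; the Laplace transform of 1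
- cos then leaves the integral of u^(a-1) / (1 + u²). Working with `lintegral` delivers
integrability along with the value. -/
theorem lintegral_one_sub_cos {a : ℝ} (h0 : 0 < a) (h2 : a < 2) :
    ∫⁻ x in Set.Ioi (0 : ℝ), ENNReal.ofReal ((1 - Real.cos x) * (1 / x ^ (1 + a))) =
      ENNReal.ofReal (cosMoment a) := by
  have hG : 0 < Real.Gamma (a + 1) := Real.Gamma_pos_of_pos (by linarith)
  have e1 : ∀ x ∈ Set.Ioi (0 : ℝ), ENNReal.ofReal ((1 - Real.cos x) * (1 / x ^ (1 + a))) =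
      ∫⁻ u in Set.Ioi (0 : ℝ), ENNReal.ofReal
        ((1 - Real.cos x) / Real.Gamma (a + 1) * (u ^ (a + 1 - 1) * Real.exp (-(x * u)))) := by
    intro x hx
    have hx' : 0 < x := hx
    have hcos := sub_nonneg.2 (Real.cos_le_one x)
    symm
    -- Where cos x = 1 the value is 0 and cannot certify integrability, so this case is separate.
    rcases hcos.eq_or_lt with h | h
    · simp [← h]
    apply setLIntegral_ofReal_of_setIntegral_eq
    · intro u hu
      have : (0 : ℝ) < u := hu
      positivity
    · rw [integral_const_mul, Real.integral_rpow_mul_exp_neg_mul_Ioi (by linarith) hx',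
        Real.div_rpow zero_le_one hx'.le, Real.one_rpow, add_comm 1 a]
      field_simp
    · positivity
  have e2 : ∀ u ∈ Set.Ioi (0 : ℝ),
      ∫⁻ x in Set.Ioi (0 : ℝ), ENNReal.ofReal
        ((1 - Real.cos x) / Real.Gamma (a + 1) * (u ^ (a + 1 - 1) * Real.exp (-(x * u)))) =
      ENNReal.ofReal (1 / Real.Gamma (a + 1)) *
        ENNReal.ofReal (u ^ (a - 1) / (1 + u ^ 2)) := by
    intro u hu
    have hu' : 0 < u := hu
    rw [← ENNReal.ofReal_mul (by positivity)]
    apply setLIntegral_ofReal_of_setIntegral_eq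
    · intro x hx
      have hcos := sub_nonneg.2 (Real.cos_le_one x)
      positivity
    · have h3 : ∀ x : ℝ, (1 - Real.cos x) / Real.Gamma (a + 1) *
          (u ^ (a + 1 - 1) * Real.exp (-(x * u))) =
          u ^ a / Real.Gamma (a + 1) * ((1 - Real.cos x) * Real.exp (-(u * x))) := by
        intro x
        rw [mul_comm x u, add_sub_cancel_right]; ring
      simp_rw [h3]
      rw [integral_const_mul, setIntegral_one_sub_cos_mul_exp hu', Real.rpow_sub_one hu'.ne']
      field_simp
    · positivity
  rw [setLIntegral_congr_fun measurableSet_Ioi e1, lintegral_lintegral_swap,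
    setLIntegral_congr_fun measurableSet_Ioi e2, lintegral_const_mul _ (by fun_prop),
    lintegral_rpow_div_one_add_sq h0 h2, ← ENNReal.ofReal_mul (by positivity)]
  · congr 1
    unfold cosMoment
    have := (sin_half_pos h0 h2).ne'
    field_simp
  · apply Measurable.aemeasurable
    unfold Function.uncurry
    fun_prop

theorem integrableOn_one_sub_cos {a : ℝ} (h0 : 0 < a) (h2 : a < 2) :
    IntegrableOn (fun x : ℝ => (1 - Real.cos x) * (1 / x ^ (1 + a))) (Set.Ioi 0) := by
  refine ⟨Measurable.aestronglyMeasurable (by fun_prop), ?_⟩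
  rw [hasFiniteIntegral_iff_ofReal, lintegral_one_sub_cos h0 h2]
  · exact ENNReal.ofReal_lt_top
  · refine (ae_restrict_iff' measurableSet_Ioi).2 (Eventually.of_forall fun x hx => ?_)
    have : (0 : ℝ) < x := hx
    have hcos := sub_nonneg.2 (Real.cos_le_one x)
    simp only [Pi.zero_apply]
    positivity

theorem integral_one_sub_cos {a : ℝ} (h0 : 0 < a) (h2 : a < 2) :
    ∫ x in Set.Ioi (0 : ℝ), (1 - Real.cos x) * (1 / x ^ (1 + a)) = cosMoment a := by
  rw [integral_eq_lintegral_of_nonneg_ae, lintegral_one_sub_cos h0 h2,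
    ENNReal.toReal_ofReal (cosMoment_pos h0 h2).le]
  · refine (ae_restrict_iff' measurableSet_Ioi).2 (Eventually.of_forall fun x hx => ?_)
    have : (0 : ℝ) < x := hx
    have hcos := sub_nonneg.2 (Real.cos_le_one x)
    simp only [Pi.zero_apply]
    positivity
  · exact Measurable.aestronglyMeasurable (by fun_prop)

theorem setIntegral_one_sub_cos_mul {a : ℝ} (h0 : 0 < a) (h2 : a < 2) (m : ℝ) :
    IntegrableOn (fun x : ℝ => (1 - Real.cos (m * x)) * (1 / x ^ (1 + a))) (Set.Ioi 0) ∧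
    ∫ x in Set.Ioi (0 : ℝ), (1 - Real.cos (m * x)) * (1 / x ^ (1 + a)) =
      |m| ^ a * cosMoment a := by
  rcases eq_or_ne m 0 with rfl | hm
  · simp [Real.zero_rpow h0.ne']
  have hm' : 0 < |m| := abs_pos.2 hm
  have key : ∀ x ∈ Set.Ioi (0 : ℝ), (1 - Real.cos (m * x)) * (1 / x ^ (1 + a)) =
      |m| ^ (1 + a) * ((1 - Real.cos (|m| * x)) * (1 / (|m| * x) ^ (1 + a))) := by
    intro x hx
    have hx' : 0 < x := hx
    rw [Real.mul_rpow hm'.le hx'.le]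
    have : Real.cos (|m| * x) = Real.cos (m * x) := by
      rw [← Real.cos_abs (m * x), abs_mul, abs_of_pos hx']
    rw [this]
    have : 0 < |m| ^ (1 + a) := by positivity
    have : 0 < x ^ (1 + a) := by positivity
    field_simp
  constructor
  · rw [integrableOn_congr_fun key measurableSet_Ioi]
    apply Integrable.const_mul
    have := (integrableOn_Ioi_comp_mul_left_iff
      (fun x : ℝ => (1 - Real.cos x) * (1 / x ^ (1 + a))) 0 hm').2
    rw [mul_zero] at this
    exact this (integrableOn_one_sub_cos h0 h2)
  · rw [setIntegral_congr_fun measurableSet_Ioi key, integral_const_mul,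
      integral_comp_mul_left_Ioi (fun x : ℝ => (1 - Real.cos x) * (1 / x ^ (1 + a))) 0 hm',
      mul_zero, integral_one_sub_cos h0 h2, smul_eq_mul, ← mul_assoc, Real.rpow_add hm',
      Real.rpow_one]
    field_simp

theorem one_sub_cos_le_sq (x : ℝ) : 1 - Real.cos x ≤ x ^ 2 / 2 := by
  linarith [Real.one_sub_sq_div_two_le_cos (x := x)]

/-! ### The improper integral A_s -/

theorem intervalIntegrable_integrandA {s : ℝ} (hs : 1 / 2 < s) {R : ℝ} (hR : 0 ≤ R) :
    IntervalIntegrable (integrandA s) volume 0 R := by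
  have h2 : 1 / s < 2 := by
    rw [div_lt_iff₀ (by linarith)]; linarith
  have h1 : IntervalIntegrable (fun x : ℝ => x ^ (1 - 1 / s)) volume 0 R :=
    intervalIntegral.intervalIntegrable_rpow' (by linarith)
  refine h1.mono_fun (Measurable.aestronglyMeasurable (by unfold integrandA; fun_prop)) ?_
  refine (ae_restrict_iff' measurableSet_uIoc).2 (Eventually.of_forall fun x hx => ?_)
  rw [Set.uIoc_of_le hR] at hx
  have hx0 : 0 < x := hx.1
  unfold integrandA
  beta_reduce
  rw [norm_mul, Real.rpow_sub hx0, Real.rpow_one, norm_div, norm_div, norm_one, mul_one_div]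
  gcongr
  exact Real.abs_sin_le_abs

/-- Integration by parts with 1 - cos, rather than -cos, as antiderivative of sin: it kills the
boundary term at 0 and leaves an absolutely convergent integral. -/
theorem integral_integrandA {s : ℝ} (hs : 1 / 2 < s) {R : ℝ} (hR : 0 < R) :
    ∫ x in (0 : ℝ)..R, integrandA s x = (1 - Real.cos R) * (1 / R ^ (1 / s)) +
      1 / s * ∫ x in (0 : ℝ)..R, (1 - Real.cos x) * (1 / x ^ (1 + 1 / s)) := by
  have hs0 : 0 < s := by linarith
  have h0 : 0 < 1 / s := by positivity
  have h2 : 1 / s < 2 := by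
    rw [div_lt_iff₀ (by linarith)]; linarith
  set a := 1 / s with ha
  have hint : IntervalIntegrable (fun x : ℝ => (1 - Real.cos x) * (1 / x ^ (1 + a))) volume 0 R := by
    rw [intervalIntegrable_iff_integrableOn_Ioc_of_le hR.le]
    exact (integrableOn_one_sub_cos h0 h2).mono_set Set.Ioc_subset_Ioi_self
  have key : ∫ x in (0 : ℝ)..R, (integrandA s x - a * ((1 - Real.cos x) * (1 / x ^ (1 + a)))) =
      (1 - Real.cos R) * (1 / R ^ a) - (1 - Real.cos 0) * (1 / (0 : ℝ) ^ a) := by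
    apply intervalIntegral.integral_eq_sub_of_hasDerivAt_of_le hR.le
      (f := fun x : ℝ => (1 - Real.cos x) * (1 / x ^ a))
    · intro x hx
      rcases hx.1.eq_or_lt with rfl | hx0
      -- Continuity at the endpoint 0: the boundary function is squeezed below x^(2-a) / 2, and a <
      -- 2.
      · have hl : Tendsto (fun x : ℝ => x ^ (2 - a) / 2) (𝓝[Set.Icc 0 R] 0) (𝓝 0) := by
          have : ContinuousAt (fun x : ℝ => x ^ (2 - a) / 2) 0 :=
            (continuousAt_id.rpow_const (Or.inr (by linarith))).div_const 2
          have h3 := this.tendsto.mono_left (nhdsWithin_le_nhds (s := Set.Icc 0 R))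
          simpa [Real.zero_rpow (by linarith : 2 - a ≠ 0)] using h3
        rw [ContinuousWithinAt, Real.cos_zero, sub_self, zero_mul]
        refine squeeze_zero' ?_ ?_ hl
        · filter_upwards [self_mem_nhdsWithin] with x hx
          exact mul_nonneg (sub_nonneg.2 (Real.cos_le_one x))
            (one_div_nonneg.2 (Real.rpow_nonneg hx.1 a))
        · filter_upwards [self_mem_nhdsWithin] with x hx
          rcases hx.1.eq_or_lt with rfl | hx0
          · simp [Real.zero_rpow (by linarith : 2 - a ≠ 0)]
          rw [Real.rpow_sub hx0, Real.rpow_two, div_right_comm, mul_one_div]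
          gcongr
          exact one_sub_cos_le_sq x
      · apply ContinuousAt.continuousWithinAt
        have : x ^ a ≠ 0 := by positivity
        fun_prop (disch := first | assumption | exact Or.inl hx0.ne')
    · intro x hx
      have hx0 : 0 < x := hx.1
      have h3 := ((Real.hasDerivAt_cos x).const_sub 1).mul
        (Real.hasDerivAt_rpow_const (x := x) (p := -a) (Or.inl hx0.ne'))
      have h4 : ∀ᶠ y in 𝓝 x, (1 - Real.cos y) * (1 / y ^ a) = (1 - Real.cos y) * y ^ (-a) := by
        filter_upwards [lt_mem_nhds hx0] with y hy
        rw [Real.rpow_neg hy.le, one_div]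
      refine (HasDerivAt.congr_of_eventuallyEq ?_ h4)
      convert! h3 using 1
      unfold integrandA
      rw [← ha, Real.rpow_neg hx0.le, one_div, one_div, ← Real.rpow_neg hx0.le (1 + a)]
      have : -(1 + a) = -a - 1 := by ring
      rw [this]; ring
    · exact (intervalIntegrable_integrandA hs hR.le).sub (hint.const_mul a)
  rw [intervalIntegral.integral_sub (intervalIntegrable_integrandA hs hR.le) (hint.const_mul a),
    intervalIntegral.integral_const_mul] at key
  simp only [Real.cos_zero, sub_self, zero_mul, sub_zero] at key
  linarith

theorem tendsto_integral_integrandA {s : ℝ} (hs : 1 / 2 < s) :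
    Tendsto (fun R : ℝ => ∫ ξ in (0 : ℝ)..R, integrandA s ξ) atTop
      (𝓝 (1 / s * cosMoment (1 / s))) := by
  have hs0 : 0 < s := by linarith
  have h0 : 0 < 1 / s := by positivity
  have h2 : 1 / s < 2 := by
    rw [div_lt_iff₀ (by linarith)]; linarith
  have h1 : Tendsto (fun R : ℝ => (1 - Real.cos R) * (1 / R ^ (1 / s))) atTop (𝓝 0) := by
    have h3 : Tendsto (fun R : ℝ => 2 * R ^ (-(1 / s))) atTop (𝓝 0) := by
      simpa using (tendsto_rpow_neg_atTop h0).const_mul 2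
    refine squeeze_zero' ?_ ?_ h3
    · filter_upwards [eventually_gt_atTop 0] with R hR
      have := sub_nonneg.2 (Real.cos_le_one R)
      positivity
    · filter_upwards [eventually_gt_atTop 0] with R hR
      rw [Real.rpow_neg hR.le, ← one_div]
      gcongr
      linarith [Real.neg_one_le_cos R]
  have h3 := intervalIntegral_tendsto_integral_Ioi 0 (integrableOn_one_sub_cos h0 h2) tendsto_id
  rw [integral_one_sub_cos h0 h2] at h3
  have h4 := h1.add (h3.const_mul (1 / s))
  rw [zero_add] at h4
  refine h4.congr' ?_
  filter_upwards [eventually_gt_atTop 0] with R hR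
  exact (integral_integrandA hs hR).symm

theorem coeffA_eq {s : ℝ} (hs : 1 / 2 < s) : coeffA s = 1 / s * cosMoment (1 / s) :=
  (tendsto_integral_integrandA hs).limUnder_eq

/-- Reflection formula at a, with sin(πa) split by the double-angle formula. At a = 1 the cosine
vanishes against a pole of Γ. -/
theorem gamma_mul_cos_eq {a : ℝ} (h0 : 0 < a) (h2 : a < 2) (h1 : a ≠ 1) :
    Real.Gamma (1 - a) * Real.cos (Real.pi * (a / 2)) = a * cosMoment a := by
  have hsin := (sin_half_pos h0 h2).ne'
  have hcos : Real.cos (Real.pi * (a / 2)) ≠ 0 := by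
    rcases lt_or_gt_of_ne h1 with h | h
    · apply ne_of_gt
      apply Real.cos_pos_of_mem_Ioo
      constructor <;> nlinarith [Real.pi_pos]
    · apply ne_of_lt
      apply Real.cos_neg_of_pi_div_two_lt_of_lt <;> nlinarith [Real.pi_pos]
  have hG := (Real.Gamma_pos_of_pos h0).ne'
  have hr := Real.Gamma_mul_Gamma_one_sub a
  have hd : Real.sin (Real.pi * a) =
      2 * Real.sin (Real.pi * (a / 2)) * Real.cos (Real.pi * (a / 2)) := by
    rw [← Real.sin_two_mul]; congr 1; ring
  rw [hd] at hr
  unfold cosMoment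
  rw [Real.Gamma_add_one h0.ne']
  rw [eq_div_iff (by positivity)] at hr
  rw [← mul_div_assoc a Real.pi, eq_div_iff (by positivity)]
  linear_combination a * hr

theorem coeffA_eq_gamma {s : ℝ} (hs : 1 / 2 < s) (h1 : s ≠ 1) :
    coeffA s = Real.Gamma (1 - 1 / s) * Real.cos (Real.pi / (2 * s)) := by
  have hs0 : 0 < s := by linarith
  have h2 : 1 / s < 2 := by
    rw [div_lt_iff₀ (by linarith)]; linarith
  have h3 : Real.pi / (2 * s) = Real.pi * (1 / s / 2) := by field_simp
  rw [coeffA_eq hs, h3, gamma_mul_cos_eq (by positivity) h2]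
  intro h
  rw [div_eq_one_iff_eq hs0.ne'] at h
  exact h1 h.symm

theorem coeffA_one : coeffA 1 = Real.pi / 2 := by
  have h3 : Real.pi * (1 / 2) = Real.pi / 2 := by ring
  have h4 : Real.Gamma (1 + 1) = 1 := by simp [one_add_one_eq_two]
  rw [coeffA_eq (by norm_num), cosMoment]
  rw [one_div_one, h3, Real.sin_pi_div_two, h4]
  ring

/-- The 0 · ∞ form is avoided: off r = 1 the product equals `1 / r * cosMoment (1 / r)`, which is
continuous at 1. -/
theorem tendsto_gamma_mul_cos :
    Tendsto (fun r : ℝ => Real.Gamma (1 - 1 / r) * Real.cos (Real.pi / (2 * r)))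
      (𝓝[≠] 1) (𝓝 (coeffA 1)) := by
  have hc : ContinuousAt (fun r : ℝ => 1 / r * cosMoment (1 / r)) 1 := by
    have hi : ContinuousAt (fun r : ℝ => 1 / r) 1 := by
      apply ContinuousAt.div₀ <;> first | fun_prop | norm_num
    have hcm : ContinuousAt cosMoment (1 / 1) := by
      unfold cosMoment
      have h5 : ContinuousAt (fun a : ℝ => Real.Gamma (a + 1)) (1 / 1) := by
        have h6 : ContinuousAt Real.Gamma (1 / 1 + 1) := by
          apply (Real.differentiableAt_Gamma _).continuousAt
          intro m
          have : (0 : ℝ) ≤ m := m.cast_nonneg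
          norm_num
          linarith
        exact ContinuousAt.comp (f := fun a : ℝ => a + 1) h6 (by fun_prop)
      have h7 := (sin_half_pos one_pos one_lt_two).ne'
      have h8 : 0 < Real.Gamma (1 / 1 + 1) := Real.Gamma_pos_of_pos (by norm_num)
      refine ContinuousAt.div₀ (by fun_prop) (by fun_prop) ?_
      rw [one_div_one] at *
      positivity
    exact hi.mul (ContinuousAt.comp (f := fun r : ℝ => 1 / r) hcm hi)
  have h9 : coeffA 1 = 1 / 1 * cosMoment (1 / 1) := coeffA_eq (by norm_num)
  rw [h9]
  refine (hc.tendsto.mono_left nhdsWithin_le_nhds).congr' ?_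
  filter_upwards [self_mem_nhdsWithin, mem_nhdsWithin_of_mem_nhds
    (lt_mem_nhds (by norm_num : (1 / 2 : ℝ) < 1))] with r h1 hr
  rw [← coeffA_eq hr, coeffA_eq_gamma hr h1]

/-! ### Cosine powers and the series B_{p;s} -/

theorem cos_pow_eq_sum (x : ℝ) (m : ℕ) :
    Real.cos x ^ m = 1 / 2 ^ m *
      ∑ k ∈ Finset.range (m + 1), (m.choose k : ℝ) * Real.cos (((m : ℝ) - 2 * k) * x) := by
  have h : (Complex.cos x) ^ m = 1 / 2 ^ m *
      ∑ k ∈ Finset.range (m + 1), (m.choose k : ℂ) * Complex.exp ((((m - 2 * k) * x : ℝ)) * Complex.I) := by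
    rw [Complex.cos, add_comm, div_pow, add_pow, div_eq_mul_one_div, mul_comm]
    congr 1
    refine Finset.sum_congr rfl fun k hk => ?_
    have hk' : k ≤ m := Nat.lt_succ_iff.1 (Finset.mem_range.1 hk)
    rw [← Complex.exp_nat_mul, ← Complex.exp_nat_mul, ← Complex.exp_add, mul_comm]
    congr 2
    push_cast [Nat.cast_sub hk']
    ring
  have h2 := congrArg Complex.re h
  have e1 : (Complex.cos x) ^ m = ((Real.cos x ^ m : ℝ) : ℂ) := by push_cast; rfl
  have e2 : (1 / 2 ^ m : ℂ) = ((1 / 2 ^ m : ℝ) : ℂ) := by push_cast; rfl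
  rw [e1, e2, Complex.ofReal_re, Complex.re_ofReal_mul, Complex.re_sum] at h2
  rw [h2]
  congr 1
  refine Finset.sum_congr rfl fun k _ => ?_
  rw [← Complex.ofReal_natCast, Complex.re_ofReal_mul, Complex.exp_ofReal_mul_I_re]

/-- The binomial coefficients sum to 2^m, so the 1 distributes over the terms and each becomes O(x²)
at 0, hence integrable against x^(-1-a). -/
theorem one_sub_cos_pow_eq_sum (x : ℝ) (m : ℕ) :
    1 - Real.cos x ^ m = 1 / 2 ^ m *
      ∑ k ∈ Finset.range (m + 1), (m.choose k : ℝ) * (1 - Real.cos (((m : ℝ) - 2 * k) * x)) := by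
  have h : ∑ k ∈ Finset.range (m + 1), (m.choose k : ℝ) = 2 ^ m := by
    exact_mod_cast Nat.sum_range_choose m
  simp_rw [mul_sub, Finset.sum_sub_distrib]
  rw [mul_sub, ← cos_pow_eq_sum]
  simp [h]

/-- The coefficient of `cosMoment` in `∫_0^∞ (1 - cos ^ m x) x ^ (-(1 + a)) dx`. -/
noncomputable def cosPowMoment (a : ℝ) (m : ℕ) : ℝ :=
  1 / 2 ^ m * ∑ k ∈ Finset.range (m + 1), (m.choose k : ℝ) * |(m : ℝ) - 2 * k| ^ a

theorem setIntegral_one_sub_cos_pow {a : ℝ} (h0 : 0 < a) (h2 : a < 2) (m : ℕ) :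
    IntegrableOn (fun x : ℝ => (1 - Real.cos x ^ m) * (1 / x ^ (1 + a))) (Set.Ioi 0) ∧
    ∫ x in Set.Ioi (0 : ℝ), (1 - Real.cos x ^ m) * (1 / x ^ (1 + a)) =
      cosPowMoment a m * cosMoment a := by
  have h : (fun x : ℝ => (1 - Real.cos x ^ m) * (1 / x ^ (1 + a))) = fun x =>
      ∑ k ∈ Finset.range (m + 1), (1 / 2 ^ m * (m.choose k : ℝ)) *
        ((1 - Real.cos (((m : ℝ) - 2 * k) * x)) * (1 / x ^ (1 + a))) := by
    ext x
    rw [one_sub_cos_pow_eq_sum, mul_assoc, Finset.sum_mul, Finset.mul_sum]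
    exact Finset.sum_congr rfl fun k _ => by ring
  have hi : ∀ k ∈ Finset.range (m + 1), IntegrableOn (fun x : ℝ => (1 / 2 ^ m * (m.choose k : ℝ)) *
        ((1 - Real.cos (((m : ℝ) - 2 * k) * x)) * (1 / x ^ (1 + a)))) (Set.Ioi 0) :=
    fun k _ => (setIntegral_one_sub_cos_mul h0 h2 _).1.const_mul _
  rw [h]
  refine ⟨integrable_finsetSum _ hi, ?_⟩
  rw [integral_finsetSum _ hi, cosPowMoment, mul_assoc, Finset.sum_mul, Finset.mul_sum]
  refine Finset.sum_congr rfl fun k _ => ?_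
  rw [integral_const_mul, (setIntegral_one_sub_cos_mul h0 h2 _).2]
  ring

theorem cosPowMoment_nonneg (a : ℝ) (m : ℕ) : 0 ≤ cosPowMoment a m := by
  unfold cosPowMoment
  positivity

/-- A crude polynomial bound, enough against the geometric factor (p / (1 - p))^n. The shift to m +
1 makes the base at least 1, so the exponent a may be raised to 2. -/
theorem cosPowMoment_le {a : ℝ} (h0 : 0 < a) (h2 : a < 2) (m : ℕ) :
    cosPowMoment a (m + 1) ≤ ((m + 1 : ℕ) : ℝ) ^ 2 := by
  have h : ∑ k ∈ Finset.range (m + 1 + 1), ((m + 1).choose k : ℝ) = 2 ^ (m + 1) := by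
    exact_mod_cast Nat.sum_range_choose (m + 1)
  have h3 : ∑ k ∈ Finset.range (m + 1 + 1), ((m + 1).choose k : ℝ) * |((m + 1 : ℕ) : ℝ) - 2 * k| ^ a
      ≤ ∑ k ∈ Finset.range (m + 1 + 1), ((m + 1).choose k : ℝ) * ((m + 1 : ℕ) : ℝ) ^ 2 := by
    refine Finset.sum_le_sum fun k hk => ?_
    have hk' : (k : ℝ) ≤ ((m + 1 : ℕ) : ℝ) := by
      exact_mod_cast Nat.lt_succ_iff.1 (Finset.mem_range.1 hk)
    have hk0 : (0 : ℝ) ≤ k := k.cast_nonneg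
    gcongr
    have h1 : (1 : ℝ) ≤ ((m + 1 : ℕ) : ℝ) := by simp
    calc |((m + 1 : ℕ) : ℝ) - 2 * k| ^ a ≤ ((m + 1 : ℕ) : ℝ) ^ a := by
          gcongr
          rw [abs_le]; constructor <;> linarith
      _ ≤ ((m + 1 : ℕ) : ℝ) ^ (2 : ℝ) := Real.rpow_le_rpow_of_exponent_le h1 h2.le
      _ = _ := Real.rpow_two _
  rw [← Finset.sum_mul, h] at h3
  rw [cosPowMoment, div_mul_eq_mul_div, one_mul, div_le_iff₀ (by positivity)]
  linarith

/-- The ceiling is ⌊n/2⌋, also at n = 0, where the natural ceiling of -1/2 is 0. So the sum runs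
over the k for which 1 + n - 2k is positive. -/
theorem range_ceil_eq_filter (n : ℕ) : Finset.range (⌈((n : ℝ) - 1) / 2⌉₊ + 1) =
    (Finset.range (n + 1 + 1)).filter (fun k => 2 * k < n + 1) := by
  have hc : ⌈((n : ℝ) - 1) / 2⌉₊ = n / 2 := by
    apply le_antisymm
    · rw [Nat.ceil_le, div_le_iff₀ two_pos]
      have : n ≤ n / 2 * 2 + 1 := by omega
      have : (n : ℝ) ≤ ((n / 2 : ℕ) : ℝ) * 2 + 1 := by exact_mod_cast this
      linarith
    · rcases Nat.eq_zero_or_pos (n / 2) with h | h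
      · omega
      obtain ⟨j, hj⟩ : ∃ j, n / 2 = j + 1 := ⟨n / 2 - 1, by omega⟩
      rw [hj, Nat.succ_le_iff, Nat.lt_ceil, lt_div_iff₀ two_pos]
      have : 2 * j + 2 ≤ n := by omega
      have : 2 * (j : ℝ) + 2 ≤ n := by exact_mod_cast this
      linarith
  rw [hc]
  ext k
  simp only [Finset.mem_range, Finset.mem_filter]
  omega

/-- The full binomial sum for exponent n + 1 folds in half under k ↦ n + 1 - k, a middle term being
0^(1/s) = 0. The identity (n+1-k) C(n+1,k) = (n+1) C(n,k) does the rest. -/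
theorem termB_eq {p s : ℝ} (hs : 0 < s) (n : ℕ) :
    termB p s n = (-1) ^ n * (p / (1 - p)) ^ (n + 1) / (n + 1) * cosPowMoment (1 / s) (n + 1) := by
  have ha : 1 / s ≠ 0 := by positivity
  rw [termB]
  set a := 1 / s
  have hsplit : ∑ k ∈ Finset.range (n + 1 + 1), ((n + 1).choose k : ℝ) * |((n + 1 : ℕ) : ℝ) - 2 * k| ^ a
      = 2 * ∑ k ∈ (Finset.range (n + 1 + 1)).filter (fun k => 2 * k < n + 1),
        ((n + 1).choose k : ℝ) * |((n + 1 : ℕ) : ℝ) - 2 * k| ^ a := by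
    rw [← Finset.sum_filter_add_sum_filter_not _ (fun k => 2 * k < n + 1), two_mul]
    congr 1
    rw [← Finset.sum_filter_add_sum_filter_not _ (fun k => 2 * k = n + 1)]
    have hz : ∑ k ∈ ((Finset.range (n + 1 + 1)).filter (fun k => ¬ 2 * k < n + 1)).filter
        (fun k => 2 * k = n + 1), ((n + 1).choose k : ℝ) * |((n + 1 : ℕ) : ℝ) - 2 * k| ^ a = 0 := by
      refine Finset.sum_eq_zero fun k hk => ?_
      have h : 2 * k = n + 1 := (Finset.mem_filter.1 hk).2
      have h' : (2 * k : ℝ) = ((n + 1 : ℕ) : ℝ) := by exact_mod_cast h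
      rw [h', sub_self, abs_zero, Real.zero_rpow ha, mul_zero]
    rw [hz, zero_add]
    refine Finset.sum_nbij' (fun k => n + 1 - k) (fun k => n + 1 - k) ?_ ?_ ?_ ?_ ?_
    · intro k hk
      simp only [Finset.mem_filter, Finset.mem_range] at hk ⊢
      omega
    · intro k hk
      simp only [Finset.mem_filter, Finset.mem_range] at hk ⊢
      omega
    · intro k hk
      simp only [Finset.mem_filter, Finset.mem_range] at hk
      omega
    · intro k hk
      simp only [Finset.mem_filter, Finset.mem_range] at hk
      omega
    · intro k hk
      simp only [Finset.mem_filter, Finset.mem_range] at hk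
      have hk' : k ≤ n + 1 := by omega
      rw [Nat.choose_symm hk', Nat.cast_sub hk', ← abs_neg]
      congr 3
      ring
  rw [cosPowMoment, hsplit, range_ceil_eq_filter, pow_succ (2 : ℝ) n]
  have hsum : ∑ k ∈ (Finset.range (n + 1 + 1)).filter (fun k => 2 * k < n + 1),
        ((n + 1).choose k : ℝ) * |((n + 1 : ℕ) : ℝ) - 2 * k| ^ a = (n + 1) *
      ∑ k ∈ (Finset.range (n + 1 + 1)).filter (fun k => 2 * k < n + 1),
        (n.choose k : ℝ) * ((1 + n - 2 * k : ℝ) ^ a / (1 + n - k : ℝ)) := by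
    rw [Finset.mul_sum]
    refine Finset.sum_congr rfl fun k hk => ?_
    simp only [Finset.mem_filter, Finset.mem_range] at hk
    have hk2 : 2 * (k : ℝ) < n + 1 := by exact_mod_cast hk.2
    have hk0 : (0 : ℝ) ≤ k := k.cast_nonneg
    have e : |((n + 1 : ℕ) : ℝ) - 2 * k| = 1 + n - 2 * k := by
      push_cast
      rw [abs_of_pos (by linarith)]; ring
    have hch := Nat.choose_mul_succ_eq n k
    have hch' : (n.choose k : ℝ) * (n + 1) = ((n + 1).choose k : ℝ) * (1 + n - k) := by
      have h3 : ((n + 1 - k : ℕ) : ℝ) = 1 + n - k := by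
        rw [Nat.cast_sub (by omega)]; push_cast; ring
      rw [← h3]
      exact_mod_cast hch
    rw [e]
    have h4 : (1 + n - k : ℝ) ≠ 0 := by linarith
    rw [← mul_assoc, mul_comm (n + 1 : ℝ), hch']
    field_simp
  rw [hsum]
  have : (n + 1 : ℝ) ≠ 0 := by positivity
  field_simp

/-- With r = p / (1 - p) < 1 the factor is (1 + r cos x) / (1 + r). Subtracting the two logarithmic
series produces the differences 1 - cos^(n+1) x. -/
theorem hasSum_neg_log_factor {p : ℝ} (hp : 0 < p) (hp2 : p < 1 / 2) (x : ℝ) :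
    HasSum (fun n : ℕ => (-1) ^ n * (p / (1 - p)) ^ (n + 1) / (n + 1) * (1 - Real.cos x ^ (n + 1)))
      (-Real.log |1 - p + p * Real.cos x|) := by
  have h1p : 0 < 1 - p := by linarith
  set r := p / (1 - p) with hr
  have hr0 : 0 < r := by positivity
  have hr1 : r < 1 := by
    rw [hr, div_lt_one h1p]; linarith
  have hc := Real.abs_cos_le_one x
  have hrc : |-(r * Real.cos x)| < 1 := by
    rw [abs_neg, abs_mul, abs_of_pos hr0]
    nlinarith [abs_nonneg (Real.cos x)]
  have hrr : |-r| < 1 := by rwa [abs_neg, abs_of_pos hr0]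
  have h := (Real.hasSum_pow_div_log_of_abs_lt_one hrc).sub
    (Real.hasSum_pow_div_log_of_abs_lt_one hrr)
  have hpos : 0 < 1 + r * Real.cos x := by
    have := (abs_lt.1 hrc).2; linarith
  have hval : -Real.log |1 - p + p * Real.cos x| =
      -Real.log (1 - -(r * Real.cos x)) - -Real.log (1 - -r) := by
    have h3 : 1 - p + p * Real.cos x = (1 + r * Real.cos x) / (1 + r) := by
      rw [hr]; field_simp; ring
    rw [h3, abs_of_pos (by positivity), Real.log_div hpos.ne' (by positivity)]
    simp only [sub_neg_eq_add]
    ring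
  rw [hval]
  convert! h using 2 with n
  rw [neg_pow (r * Real.cos x), mul_pow, neg_pow r, pow_succ (-1 : ℝ)]
  ring

/-- Termwise integration: since 1 - cos^(n+1) x ≥ 0, the L¹ norms are the same moments without the
alternating sign, and these are summable. -/
theorem hasSum_termB {p s : ℝ} (hp : 0 < p) (hp2 : p < 1 / 2) (hs : 1 / 2 < s) :
    HasSum (fun n => termB p s n * cosMoment (1 / s))
      (∫ ξ in Set.Ioi (0 : ℝ), -integrandC p s ξ) := by
  have hs0 : 0 < s := by linarith
  have h0 : 0 < 1 / s := by positivity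
  have h2 : 1 / s < 2 := by
    rw [div_lt_iff₀ (by linarith)]; linarith
  have h1p : 0 < 1 - p := by linarith
  have hr0 : 0 < p / (1 - p) := by positivity
  have hr1 : p / (1 - p) < 1 := by
    rw [div_lt_one h1p]; linarith
  have hJ := cosMoment_pos h0 h2
  have hint : ∀ n : ℕ, ∫ x in Set.Ioi (0 : ℝ),
      (-1) ^ n * (p / (1 - p)) ^ (n + 1) / (n + 1) *
        ((1 - Real.cos x ^ (n + 1)) * (1 / x ^ (1 + 1 / s))) =
      termB p s n * cosMoment (1 / s) := by
    intro n
    rw [integral_const_mul, (setIntegral_one_sub_cos_pow h0 h2 _).2, termB_eq hs0, mul_assoc]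
  have hnorm : ∀ n : ℕ, ∫ x in Set.Ioi (0 : ℝ),
      ‖(-1) ^ n * (p / (1 - p)) ^ (n + 1) / (n + 1) *
        ((1 - Real.cos x ^ (n + 1)) * (1 / x ^ (1 + 1 / s)))‖ =
      (p / (1 - p)) ^ (n + 1) / (n + 1) * (cosPowMoment (1 / s) (n + 1) * cosMoment (1 / s)) := by
    intro n
    rw [← (setIntegral_one_sub_cos_pow h0 h2 _).2, ← integral_const_mul]
    refine setIntegral_congr_fun measurableSet_Ioi fun x hx => ?_
    have hx0 : (0 : ℝ) < x := hx
    have h3 : Real.cos x ^ (n + 1) ≤ 1 := by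
      refine (le_abs_self _).trans ?_
      rw [abs_pow]
      exact pow_le_one₀ (abs_nonneg _) (Real.abs_cos_le_one x)
    have h4 : 0 ≤ 1 - Real.cos x ^ (n + 1) := by linarith
    rw [norm_mul, norm_div, norm_mul, norm_pow, norm_neg, norm_one, one_pow, one_mul,
      Real.norm_of_nonneg (by positivity : 0 ≤ (p / (1 - p)) ^ (n + 1)),
      Real.norm_of_nonneg (by positivity : (0 : ℝ) ≤ n + 1),
      Real.norm_of_nonneg (by positivity)]
  have hsum : Summable (fun n : ℕ => (p / (1 - p)) ^ (n + 1) / (n + 1) *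
      (cosPowMoment (1 / s) (n + 1) * cosMoment (1 / s))) := by
    have h3 : Summable (fun n : ℕ => ((n : ℝ)) ^ 2 * (p / (1 - p)) ^ n) :=
      summable_pow_mul_geometric_of_norm_lt_one 2 (by rwa [Real.norm_of_nonneg hr0.le])
    have h4 := ((summable_nat_add_iff 1).2 h3).mul_right (cosMoment (1 / s))
    refine Summable.of_nonneg_of_le (fun n => ?_) (fun n => ?_) h4
    · have := cosPowMoment_nonneg (1 / s) (n + 1)
      positivity
    · have h5 := cosPowMoment_le h0 h2 n
      rw [← mul_assoc, mul_comm (((n + 1 : ℕ) : ℝ) ^ 2)]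
      refine mul_le_mul_of_nonneg_right ?_ hJ.le
      refine mul_le_mul ?_ h5 (cosPowMoment_nonneg _ _) (by positivity)
      exact div_le_self (by positivity) (by simp)
  have hmain := hasSum_integral_of_summable_integral_norm
    (μ := volume.restrict (Set.Ioi (0 : ℝ)))
    (F := fun (n : ℕ) (x : ℝ) => (-1) ^ n * (p / (1 - p)) ^ (n + 1) / (n + 1) *
        ((1 - Real.cos x ^ (n + 1)) * (1 / x ^ (1 + 1 / s))))
    (fun n => (setIntegral_one_sub_cos_pow h0 h2 _).1.const_mul _)
    (by simp_rw [hnorm]; exact hsum)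
  simp_rw [hint] at hmain
  convert! hmain using 1
  refine setIntegral_congr_fun measurableSet_Ioi fun x hx => ?_
  have h6 := (hasSum_neg_log_factor hp hp2 x).mul_right (1 / x ^ (1 + 1 / s))
  simp only [integrandC]
  rw [← neg_mul, ← h6.tsum_eq]
  exact tsum_congr fun n => by ring

theorem coeffC_eq_coeffA_mul_coeffB {p s : ℝ} (hp : 0 < p) (hp2 : p < 1 / 2) (hs : 1 / 2 < s) :
    Summable (termB p s) ∧ coeffC p s = coeffA s * coeffB p s := by
  have hs0 : 0 < s := by linarith
  have h0 : 0 < 1 / s := by positivity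
  have h2 : 1 / s < 2 := by
    rw [div_lt_iff₀ (by linarith)]; linarith
  have h := hasSum_termB hp hp2 hs
  have hJ := (cosMoment_pos h0 h2).ne'
  refine ⟨(summable_mul_right_iff hJ).1 h.summable, ?_⟩
  have h3 := h.tsum_eq
  rw [tsum_mul_right, integral_neg] at h3
  rw [coeffC, coeffA_eq hs, coeffB, mul_assoc, mul_comm (cosMoment _), h3]
  ring

/-! ### Weighted integrals of functions with linearly bounded mean -/

/-- Dyadic decomposition: on [r, 2r] the power is at most r^e and G has integral at most 2Cr, so the
pieces r = l c^k form a geometric series of ratio c^(e+1). Taking c = 1/2 descends to 0, and c = 2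
climbs to infinity. -/
theorem lintegral_rpow_mul_le_of_cover {G : ℝ → ℝ} {C : ℝ} (hC : 0 ≤ C)
    (hG : ∀ u : ℝ, 0 < u → ∫⁻ x in Set.Ioc 0 u, ENNReal.ofReal (G x) ≤ ENNReal.ofReal (C * u))
    {e c l : ℝ} (he : e ≤ 0) (hc : 0 < c) (hce : c ^ (e + 1) < 1) (hl : 0 < l) {A : Set ℝ}
    (hA : A ⊆ ⋃ k : ℕ, Set.Icc (l * c ^ k) (2 * (l * c ^ k))) :
    ∫⁻ y in A, ENNReal.ofReal (y ^ e * G y) ≤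
      ENNReal.ofReal (2 * C * l ^ (e + 1) * (1 - c ^ (e + 1))⁻¹) := by
  have hc0 : 0 < c ^ (e + 1) := by positivity
  have hpiece : ∀ k : ℕ, ∫⁻ y in Set.Icc (l * c ^ k) (2 * (l * c ^ k)),
      ENNReal.ofReal (y ^ e * G y) ≤ ENNReal.ofReal (2 * C * l ^ (e + 1) * (c ^ (e + 1)) ^ k) := by
    intro k
    set r := l * c ^ k with hr
    have hr0 : 0 < r := by positivity
    calc ∫⁻ y in Set.Icc r (2 * r), ENNReal.ofReal (y ^ e * G y)
        ≤ ∫⁻ y in Set.Icc r (2 * r), ENNReal.ofReal (r ^ e) * ENNReal.ofReal (G y) := by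
          refine setLIntegral_mono' measurableSet_Icc fun y hy => ?_
          have hy0 : 0 < y := hr0.trans_le hy.1
          rw [ENNReal.ofReal_mul (by positivity)]
          exact mul_le_mul' (ENNReal.ofReal_le_ofReal
            (Real.rpow_le_rpow_of_nonpos hr0 hy.1 he)) le_rfl
      _ ≤ ENNReal.ofReal (r ^ e) * ENNReal.ofReal (C * (2 * r)) := by
          rw [lintegral_const_mul' _ _ ENNReal.ofReal_ne_top]
          gcongr
          refine (lintegral_mono_set ?_).trans (hG (2 * r) (by positivity))
          exact fun y hy => ⟨hr0.trans_le hy.1, hy.2⟩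
      _ = ENNReal.ofReal (2 * C * l ^ (e + 1) * (c ^ (e + 1)) ^ k) := by
          rw [← ENNReal.ofReal_mul (by positivity)]
          congr 1
          have h1 : r ^ (e + 1) = l ^ (e + 1) * (c ^ (e + 1)) ^ k := by
            rw [hr, Real.mul_rpow hl.le (by positivity), ← Real.rpow_natCast, ← Real.rpow_mul hc.le,
              ← Real.rpow_natCast, ← Real.rpow_mul hc.le, mul_comm (k : ℝ)]
          rw [mul_assoc _ (l ^ (e + 1)), ← h1, Real.rpow_add_one hr0.ne']
          ring
  calc ∫⁻ y in A, ENNReal.ofReal (y ^ e * G y)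
      ≤ ∫⁻ y in ⋃ k : ℕ, Set.Icc (l * c ^ k) (2 * (l * c ^ k)), ENNReal.ofReal (y ^ e * G y) :=
        lintegral_mono_set hA
    _ ≤ ∑' k : ℕ, ∫⁻ y in Set.Icc (l * c ^ k) (2 * (l * c ^ k)), ENNReal.ofReal (y ^ e * G y) :=
        lintegral_iUnion_le _ _
    _ ≤ ∑' k : ℕ, ENNReal.ofReal (2 * C * l ^ (e + 1) * (c ^ (e + 1)) ^ k) :=
        ENNReal.tsum_le_tsum hpiece
    _ = _ := by
        rw [← ENNReal.ofReal_tsum_of_nonneg (fun k => by positivity)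
          ((summable_geometric_of_lt_one hc0.le hce).mul_left _), tsum_mul_left,
          tsum_geometric_of_lt_one hc0.le hce]

theorem exists_lintegral_Ioc_rpow_mul_le {G : ℝ → ℝ} {C : ℝ} (hC : 0 ≤ C)
    (hG : ∀ u : ℝ, 0 < u → ∫⁻ x in Set.Ioc 0 u, ENNReal.ofReal (G x) ≤ ENNReal.ofReal (C * u))
    {e : ℝ} (he : e ≤ 0) (he1 : -1 < e) : ∃ C' : ℝ, 0 ≤ C' ∧ ∀ M : ℝ, 0 < M →
      ∫⁻ y in Set.Ioc 0 M, ENNReal.ofReal (y ^ e * G y) ≤ ENNReal.ofReal (C' * M ^ (e + 1)) := by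
  have hce : (1 / 2 : ℝ) ^ (e + 1) < 1 :=
    Real.rpow_lt_one (by norm_num) (by norm_num) (by linarith)
  have hce' : 0 < 1 - (1 / 2 : ℝ) ^ (e + 1) := by linarith
  refine ⟨2 * C * (1 / 2 : ℝ) ^ (e + 1) * (1 - (1 / 2 : ℝ) ^ (e + 1))⁻¹, by positivity,
    fun M hM => ?_⟩
  refine (lintegral_rpow_mul_le_of_cover hC hG he (by norm_num) hce (half_pos hM) ?_).trans ?_
  · intro y hy
    obtain ⟨n, hn1, hn2⟩ := exists_nat_pow_near_of_lt_one (div_pos hy.1 hM)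
      ((div_le_one hM).2 hy.2) (by norm_num : (0 : ℝ) < 1 / 2) (by norm_num)
    rw [lt_div_iff₀ hM] at hn1
    rw [div_le_iff₀ hM] at hn2
    refine Set.mem_iUnion.2 ⟨n, ?_, ?_⟩
    · rw [pow_succ] at hn1; linarith
    · linarith
  · rw [div_eq_mul_one_div M 2, Real.mul_rpow hM.le (by norm_num)]
    apply le_of_eq; congr 1; ring

theorem exists_lintegral_Ici_rpow_mul_le {G : ℝ → ℝ} {C : ℝ} (hC : 0 ≤ C)
    (hG : ∀ u : ℝ, 0 < u → ∫⁻ x in Set.Ioc 0 u, ENNReal.ofReal (G x) ≤ ENNReal.ofReal (C * u))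
    {e : ℝ} (he1 : e < -1) : ∃ C' : ℝ, 0 ≤ C' ∧ ∀ M : ℝ, 0 < M →
      ∫⁻ y in Set.Ici M, ENNReal.ofReal (y ^ e * G y) ≤ ENNReal.ofReal (C' * M ^ (e + 1)) := by
  have hce : (2 : ℝ) ^ (e + 1) < 1 := Real.rpow_lt_one_of_one_lt_of_neg one_lt_two (by linarith)
  have hce' : 0 < 1 - (2 : ℝ) ^ (e + 1) := by linarith
  refine ⟨2 * C * (1 - (2 : ℝ) ^ (e + 1))⁻¹, by positivity, fun M hM => ?_⟩
  refine (lintegral_rpow_mul_le_of_cover hC hG (by linarith) two_pos hce hM ?_).trans ?_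
  · intro y hy
    obtain ⟨n, hn1, hn2⟩ := exists_nat_pow_near ((one_le_div hM).2 hy) one_lt_two
    rw [le_div_iff₀ hM] at hn1
    rw [div_lt_iff₀ hM] at hn2
    refine Set.mem_iUnion.2 ⟨n, ?_, ?_⟩
    · linarith
    · rw [pow_succ] at hn2; linarith
  · apply le_of_eq; congr 1; ring

/-! ### The change of variables `y = t / x ^ s` -/

section ChangeOfVariables

variable {t s : ℝ}

theorem hasDerivWithinAt_div_rpow {y : ℝ} (hy : 0 < y) :
    HasDerivWithinAt (fun y : ℝ => t ^ (1 / s) * y ^ (-(1 / s)))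
      (-(1 / s * t ^ (1 / s) * (1 / y ^ (1 + 1 / s)))) (Set.Ioi 0) y := by
  have h := ((Real.hasDerivAt_rpow_const (x := y) (p := -(1 / s)) (Or.inl hy.ne')).const_mul
    (t ^ (1 / s))).hasDerivWithinAt (s := Set.Ioi 0)
  convert! h using 1
  have : -(1 / s) - 1 = -(1 + 1 / s) := by ring
  rw [this, Real.rpow_neg hy.le]
  ring

theorem div_rpow_inverse (ht : 0 < t) (hs : 0 < s) {y : ℝ} (hy : 0 < y) :
    t / (t ^ (1 / s) * y ^ (-(1 / s))) ^ s = y := by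
  rw [Real.mul_rpow (by positivity) (by positivity), ← Real.rpow_mul ht.le, ← Real.rpow_mul hy.le]
  have h1 : 1 / s * s = 1 := by field_simp
  have h2 : -(1 / s) * s = -1 := by field_simp
  rw [h1, h2, Real.rpow_one, Real.rpow_neg_one]
  field_simp

theorem div_rpow_injOn (ht : 0 < t) (hs : 0 < s) :
    Set.InjOn (fun y : ℝ => t ^ (1 / s) * y ^ (-(1 / s))) (Set.Ioi 0) := by
  intro x hx y hy hxy
  rw [← div_rpow_inverse ht hs hx, ← div_rpow_inverse ht hs hy]
  simp only at hxy
  rw [hxy]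

theorem div_rpow_leftInverse (ht : 0 < t) (hs : 0 < s) {x : ℝ} (hx : 0 < x) :
    t ^ (1 / s) * (t / x ^ s) ^ (-(1 / s)) = x := by
  have h2 : s * (1 / s) = 1 := by field_simp
  rw [Real.rpow_neg (by positivity), Real.div_rpow ht.le (by positivity), ← Real.rpow_mul hx.le,
    h2, Real.rpow_one]
  field_simp

theorem div_rpow_image (ht : 0 < t) (hs : 0 < s) :
    (fun y : ℝ => t ^ (1 / s) * y ^ (-(1 / s))) '' Set.Ioi 0 = Set.Ioi 0 := by
  ext x
  constructor
  · rintro ⟨y, hy, rfl⟩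
    have : (0 : ℝ) < y := hy
    simp only [Set.mem_Ioi]
    positivity
  · intro hx
    have hx0 : (0 : ℝ) < x := hx
    exact ⟨t / x ^ s, by simp only [Set.mem_Ioi]; positivity, div_rpow_leftInverse ht hs hx0⟩

theorem lintegral_comp_div_rpow (ht : 0 < t) (hs : 0 < s) (Φ : ℝ → ENNReal) :
    ∫⁻ x in Set.Ioi (0 : ℝ), Φ (t / x ^ s) = ∫⁻ y in Set.Ioi (0 : ℝ),
      ENNReal.ofReal (1 / s * t ^ (1 / s) * (1 / y ^ (1 + 1 / s))) * Φ y := by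
  conv_lhs => rw [← div_rpow_image ht hs]
  rw [lintegral_image_eq_lintegral_abs_deriv_mul measurableSet_Ioi
    (fun y hy => hasDerivWithinAt_div_rpow hy) (div_rpow_injOn ht hs)]
  refine setLIntegral_congr_fun measurableSet_Ioi fun y hy => ?_
  have hy0 : (0 : ℝ) < y := hy
  rw [div_rpow_inverse ht hs hy0, abs_neg, abs_of_pos (by positivity)]

theorem integral_comp_div_rpow (ht : 0 < t) (hs : 0 < s) {f : ℝ → ℝ}
    (hf : IntegrableOn (fun ξ => f ξ * (1 / ξ ^ (1 + 1 / s))) (Set.Ioi 0)) :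
    IntegrableOn (fun x : ℝ => f (t / x ^ s)) (Set.Ioi 0) ∧
    ∫ x in Set.Ioi (0 : ℝ), f (t / x ^ s) =
      1 / s * t ^ (1 / s) * ∫ ξ in Set.Ioi (0 : ℝ), f ξ * (1 / ξ ^ (1 + 1 / s)) := by
  have hcongr : ∀ y ∈ Set.Ioi (0 : ℝ),
      |-(1 / s * t ^ (1 / s) * (1 / y ^ (1 + 1 / s)))| • f (t / (t ^ (1 / s) * y ^ (-(1 / s))) ^ s) =
      1 / s * t ^ (1 / s) * (f y * (1 / y ^ (1 + 1 / s))) := by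
    intro y hy
    have hy0 : (0 : ℝ) < y := hy
    rw [div_rpow_inverse ht hs hy0, abs_neg, abs_of_pos (by positivity), smul_eq_mul]
    ring
  constructor
  · conv => rw [← div_rpow_image ht hs]
    rw [integrableOn_image_iff_integrableOn_abs_deriv_smul measurableSet_Ioi
      (fun y hy => hasDerivWithinAt_div_rpow hy) (div_rpow_injOn ht hs),
      integrableOn_congr_fun hcongr measurableSet_Ioi]
    exact hf.const_mul _
  · conv_lhs => rw [← div_rpow_image ht hs]
    rw [integral_image_eq_integral_abs_deriv_smul measurableSet_Ioi
      (fun y hy => hasDerivWithinAt_div_rpow hy) (div_rpow_injOn ht hs),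
      setIntegral_congr_fun measurableSet_Ioi hcongr, integral_const_mul]

end ChangeOfVariables

/-- The substitution sends (0, N] to [t / N^s, ∞), where y^(-1-1/s) decays fast enough; t^(1/s) (t /
N^s)^(-1/s) = N. -/
theorem exists_lintegral_Ioc_comp_div_rpow_le {G : ℝ → ℝ} {C s : ℝ} (hC : 0 ≤ C) (hs : 0 < s)
    (hG : ∀ u : ℝ, 0 < u → ∫⁻ x in Set.Ioc 0 u, ENNReal.ofReal (G x) ≤ ENNReal.ofReal (C * u)) :
    ∃ C' : ℝ, 0 ≤ C' ∧ ∀ t N : ℝ, 0 < t → 0 < N →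
      ∫⁻ x in Set.Ioc 0 N, ENNReal.ofReal (G (t / x ^ s)) ≤ ENNReal.ofReal (C' * N) := by
  have he : -(1 + 1 / s) < -1 := by
    have : 0 < 1 / s := by positivity
    linarith
  obtain ⟨C', hC', h⟩ := exists_lintegral_Ici_rpow_mul_le hC hG he
  refine ⟨C' / s, by positivity, fun t N ht hN => ?_⟩
  set m := t / N ^ s with hm
  have hm0 : 0 < m := by positivity
  calc ∫⁻ x in Set.Ioc 0 N, ENNReal.ofReal (G (t / x ^ s))
      = ∫⁻ x in Set.Ioc 0 N, (Set.Ici m).indicator (fun y => ENNReal.ofReal (G y)) (t / x ^ s) := by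
        refine setLIntegral_congr_fun measurableSet_Ioc fun x hx => ?_
        rw [Set.indicator_of_mem]
        rw [Set.mem_Ici, hm]
        have := hx.1
        gcongr
        exact hx.2
    _ ≤ ∫⁻ x in Set.Ioi 0, (Set.Ici m).indicator (fun y => ENNReal.ofReal (G y)) (t / x ^ s) :=
        lintegral_mono_set Set.Ioc_subset_Ioi_self
    _ = ∫⁻ y in Set.Ioi (0 : ℝ), (Set.Ici m).indicator (fun y =>
          ENNReal.ofReal (1 / s * t ^ (1 / s)) * ENNReal.ofReal (y ^ (-(1 + 1 / s)) * G y)) y := by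
        rw [lintegral_comp_div_rpow ht hs]
        refine setLIntegral_congr_fun measurableSet_Ioi fun y hy => ?_
        have hy0 : (0 : ℝ) < y := hy
        by_cases hym : y ∈ Set.Ici m
        · simp only [Set.indicator_of_mem hym]
          rw [← ENNReal.ofReal_mul (by positivity), ← ENNReal.ofReal_mul (by positivity),
            Real.rpow_neg hy0.le, one_div (y ^ (1 + 1 / s))]
          congr 1; ring
        · simp only [Set.indicator_of_notMem hym, mul_zero]
    _ ≤ ∫⁻ y, (Set.Ici m).indicator (fun y =>
          ENNReal.ofReal (1 / s * t ^ (1 / s)) * ENNReal.ofReal (y ^ (-(1 + 1 / s)) * G y)) y :=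
        setLIntegral_le_lintegral _ _
    _ = ENNReal.ofReal (1 / s * t ^ (1 / s)) *
          ∫⁻ y in Set.Ici m, ENNReal.ofReal (y ^ (-(1 + 1 / s)) * G y) := by
        rw [lintegral_indicator measurableSet_Ici, lintegral_const_mul' _ _ ENNReal.ofReal_ne_top]
    _ ≤ ENNReal.ofReal (1 / s * t ^ (1 / s)) * ENNReal.ofReal (C' * m ^ (-(1 + 1 / s) + 1)) := by
        gcongr
        exact h m hm0
    _ = _ := by
        rw [← ENNReal.ofReal_mul (by positivity)]
        have h3 : -(1 + 1 / s) + 1 = -(1 / s) := by ring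
        have h4 := div_rpow_leftInverse ht hs hN
        rw [h3]
        congr 1
        rw [← hm] at h4
        linear_combination (C' / s) * h4

/-- Here t / x^(s+1) is the size of the increment of t / x^s. After substitution the weight is a
multiple of y^e with e = -(1 + 1/s)/3, and e > -1 because 1/s < 2. The exponent 2/3 is thus large
enough for every s > 1/2, yet below 1, so that |sin|^(-2/3) stays locally integrable. -/
theorem exists_lintegral_Ioi_comp_div_rpow_le {G : ℝ → ℝ} {C s : ℝ} (hC : 0 ≤ C) (hs : 1 / 2 < s)
    (hG : ∀ u : ℝ, 0 < u → ∫⁻ x in Set.Ioc 0 u, ENNReal.ofReal (G x) ≤ ENNReal.ofReal (C * u)) :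
    ∃ C' : ℝ, 0 ≤ C' ∧ ∀ t N : ℝ, 0 < t → t ^ (1 / (s + 1)) ≤ N →
      ∫⁻ x in Set.Ioi N, ENNReal.ofReal ((t / x ^ (s + 1)) ^ (2 / 3 : ℝ) * G (t / x ^ s)) ≤
        ENNReal.ofReal (C' * t ^ (1 / (s + 1))) := by
  have hs0 : 0 < s := by linarith
  set e := -((1 + 1 / s) / 3) with he
  have h2 : 1 / s < 2 := by
    rw [div_lt_iff₀ (by linarith)]; linarith
  have h0 : 0 < 1 / s := by positivity
  obtain ⟨C', hC', h⟩ := exists_lintegral_Ioc_rpow_mul_le hC hG (e := e)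
    (by rw [he]; linarith) (by rw [he]; linarith)
  refine ⟨C' / s, by positivity, fun t N ht hMN => ?_⟩
  set M := t ^ (1 / (s + 1)) with hM
  have hM0 : 0 < M := by positivity
  have hN : 0 < N := hM0.trans_le hMN
  have hMt : M ^ (s + 1) = t := by
    rw [hM, ← Real.rpow_mul ht.le]
    have : 1 / (s + 1) * (s + 1) = 1 := by field_simp
    rw [this, Real.rpow_one]
  set m := t / N ^ s with hm
  have hm0 : 0 < m := by positivity
  have hmM : m ≤ M := by
    rw [hm, div_le_iff₀ (by positivity)]
    calc t = M * M ^ s := by rw [← hMt, Real.rpow_add_one hM0.ne', mul_comm]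
      _ ≤ M * N ^ s := by gcongr
  set κ := 1 / s * M ^ (-e) with hκ
  have hwt : ∀ y : ℝ, 0 < y → 1 / s * t ^ (1 / s) * (1 / y ^ (1 + 1 / s)) *
      (t / (t ^ (1 / s) * y ^ (-(1 / s))) ^ (s + 1)) ^ (2 / 3 : ℝ) = κ * y ^ e := by
    intro y hy
    have ht' : 0 ≤ t ^ (1 / s) := by positivity
    have hy' : 0 ≤ y ^ (-(1 / s)) := by positivity
    rw [hκ, ← hMt, Real.mul_rpow (by positivity) hy', ← Real.rpow_mul hM0.le,
      ← Real.rpow_mul hM0.le, ← Real.rpow_mul hy.le, ← div_div, ← Real.rpow_sub hM0,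
      Real.div_rpow (by positivity) (by positivity), ← Real.rpow_mul hM0.le, ← Real.rpow_mul hy.le,
      one_div (y ^ (1 + 1 / s)), ← Real.rpow_neg hy.le, div_eq_mul_inv _ (y ^ (_ : ℝ)),
      ← Real.rpow_neg hy.le]
    have e1 : M ^ ((s + 1) * (1 / s)) * M ^ ((s + 1 - (s + 1) * (1 / s) * (s + 1)) * (2 / 3))
        = M ^ (-e) := by
      rw [← Real.rpow_add hM0]
      congr 1
      rw [he]; field_simp; ring
    have e2 : y ^ (-(1 + 1 / s)) * y ^ (-(-(1 / s) * (s + 1) * (2 / 3))) = y ^ e := by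
      rw [← Real.rpow_add hy]
      congr 1
      rw [he]; field_simp; ring
    rw [← e1, ← e2]; ring
  set Φ : ℝ → ENNReal := fun y => ENNReal.ofReal
    ((t / (t ^ (1 / s) * y ^ (-(1 / s))) ^ (s + 1)) ^ (2 / 3 : ℝ) * G y) with hΦ
  calc ∫⁻ x in Set.Ioi N, ENNReal.ofReal ((t / x ^ (s + 1)) ^ (2 / 3 : ℝ) * G (t / x ^ s))
      = ∫⁻ x in Set.Ioi N, (Set.Ioc 0 m).indicator Φ (t / x ^ s) := by
        refine setLIntegral_congr_fun measurableSet_Ioi fun x hx => ?_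
        have hx1 : N < x := hx
        have hx0 : 0 < x := hN.trans hx1
        rw [Set.indicator_of_mem]
        · simp only [hΦ]
          rw [div_rpow_leftInverse ht hs0 hx0]
        · refine ⟨by positivity, ?_⟩
          rw [hm]
          gcongr
    _ ≤ ∫⁻ x in Set.Ioi 0, (Set.Ioc 0 m).indicator Φ (t / x ^ s) :=
        lintegral_mono_set (Set.Ioi_subset_Ioi hN.le)
    _ = ∫⁻ y in Set.Ioi (0 : ℝ), (Set.Ioc 0 m).indicator (fun y =>
          ENNReal.ofReal κ * ENNReal.ofReal (y ^ e * G y)) y := by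
        rw [lintegral_comp_div_rpow ht hs0]
        refine setLIntegral_congr_fun measurableSet_Ioi fun y hy => ?_
        have hy0 : (0 : ℝ) < y := hy
        by_cases hym : y ∈ Set.Ioc 0 m
        · simp only [Set.indicator_of_mem hym, hΦ]
          rw [← ENNReal.ofReal_mul (by positivity), ← ENNReal.ofReal_mul (by positivity),
            ← mul_assoc, ← mul_assoc, hwt y hy0]
        · simp only [Set.indicator_of_notMem hym, mul_zero]
    _ ≤ ∫⁻ y, (Set.Ioc 0 m).indicator (fun y =>
          ENNReal.ofReal κ * ENNReal.ofReal (y ^ e * G y)) y :=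
        setLIntegral_le_lintegral _ _
    _ = ENNReal.ofReal κ * ∫⁻ y in Set.Ioc 0 m, ENNReal.ofReal (y ^ e * G y) := by
        rw [lintegral_indicator measurableSet_Ioc, lintegral_const_mul' _ _ ENNReal.ofReal_ne_top]
    _ ≤ ENNReal.ofReal κ * ENNReal.ofReal (C' * M ^ (e + 1)) := by
        gcongr
        exact (lintegral_mono_set (Set.Ioc_subset_Ioc_right hmM)).trans (h M hM0)
    _ = _ := by
        rw [← ENNReal.ofReal_mul (by positivity)]
        congr 1
        have h3 : M ^ (-e) * M ^ (e + 1) = M := by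
          rw [← Real.rpow_add hM0, neg_add_cancel_left, Real.rpow_one]
        rw [hκ]
        linear_combination (C' / s) * h3

/-! ### Comparison of the sum with the integral -/

/-- From (n/x)^s = exp(-s ln(x/n)) ≥ 1 - s/n. The factor 2^(s+1) pays for replacing n by x ≤ 2n,
which leaves a bound integrable in x. -/
theorem div_rpow_sub_div_rpow_le {t s n x : ℝ} (ht : 0 < t) (hs : 0 < s) (hn : 1 ≤ n)
    (hnx : n ≤ x) (hx : x ≤ n + 1) :
    |t / n ^ s - t / x ^ s| ≤ s * 2 ^ (s + 1) * (t / x ^ (s + 1)) := by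
  have hn0 : 0 < n := by linarith
  have hx0 : 0 < x := by linarith
  have hle : t / x ^ s ≤ t / n ^ s := by gcongr
  rw [abs_of_nonneg (by linarith)]
  have h1 : 1 - s / n ≤ (n / x) ^ s := by
    have h3 : Real.log (x / n) ≤ 1 / n := by
      refine (Real.log_le_sub_one_of_pos (by positivity)).trans ?_
      rw [div_sub_one hn0.ne']
      gcongr
      linarith
    have h4 : Real.log (n / x) = -Real.log (x / n) := by rw [← Real.log_inv, inv_div]
    rw [Real.rpow_def_of_pos (by positivity), h4]
    refine le_trans ?_ (Real.add_one_le_exp _)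
    have h5 : s * Real.log (x / n) ≤ s * (1 / n) := by gcongr
    rw [mul_one_div] at h5
    linarith
  have h2 : x ^ (s + 1) ≤ 2 ^ (s + 1) * n ^ (s + 1) := by
    rw [← Real.mul_rpow (by norm_num) hn0.le]
    gcongr
    linarith
  calc t / n ^ s - t / x ^ s = t / n ^ s * (1 - (n / x) ^ s) := by
        rw [Real.div_rpow hn0.le hx0.le]; field_simp
    _ ≤ t / n ^ s * (s / n) := by gcongr; linarith
    _ = s * t / n ^ (s + 1) := by rw [Real.rpow_add_one hn0.ne']; field_simp
    _ ≤ s * t * (2 ^ (s + 1) / x ^ (s + 1)) := by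
        rw [div_eq_mul_one_div]
        refine mul_le_mul_of_nonneg_left ?_ (by positivity)
        rw [div_le_div_iff₀ (by positivity) (by positivity)]
        linarith
    _ = _ := by ring

/-- Comparison of a sum over `t / n ^ s` with the corresponding integral, for a function `f` whose
increments are controlled from above by a weight of linearly bounded mean. -/
theorem exists_tsum_le_integral_add {f G : ℝ → ℝ} {S : Set ℝ} {C D s : ℝ} (hs : 1 / 2 < s)
    (hC : 0 ≤ C) (hD : 0 ≤ D) (hS : Sᶜ.Countable) (hGm : Measurable G) (hG0 : ∀ x, 0 ≤ G x)
    (hG : ∀ u : ℝ, 0 < u → ∫⁻ x in Set.Ioc 0 u, ENNReal.ofReal (G x) ≤ ENNReal.ofReal (C * u))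
    (hf : IntegrableOn (fun ξ => f ξ * (1 / ξ ^ (1 + 1 / s))) (Set.Ioi 0))
    (hfD : ∀ x, f x ≤ D) (hfG : ∀ x ∈ S, -f x ≤ G x)
    (hinc : ∀ x ∈ S, ∀ y ∈ S, f x - f y ≤ |x - y| ^ (2 / 3 : ℝ) * G y) :
    ∃ K : ℝ, 0 ≤ K ∧ ∀ t : ℝ, 1 ≤ t → (∀ n : ℕ, t / ((n + 1 : ℕ) : ℝ) ^ s ∈ S) →
      Summable (fun n : ℕ => f (t / ((n + 1 : ℕ) : ℝ) ^ s)) →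
      ∑' n : ℕ, f (t / ((n + 1 : ℕ) : ℝ) ^ s) ≤
        1 / s * t ^ (1 / s) * (∫ ξ in Set.Ioi (0 : ℝ), f ξ * (1 / ξ ^ (1 + 1 / s))) +
          K * t ^ (1 / (s + 1)) := by
  have hs0 : 0 < s := by linarith
  obtain ⟨C₁, hC₁, hhead⟩ := exists_lintegral_Ioc_comp_div_rpow_le hC hs0 hG
  obtain ⟨C₂, hC₂, htail⟩ := exists_lintegral_Ioi_comp_div_rpow_le hC hs hG
  set κ := (s * 2 ^ (s + 1)) ^ (2 / 3 : ℝ) with hκ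
  have hκ0 : 0 ≤ κ := by positivity
  -- Head terms, head integral and tail increments, in this order; the 2s come from N ≤ 2M.
  refine ⟨2 * D + 2 * C₁ + κ * C₂, by positivity, fun t ht htS hsum => ?_⟩
  have ht0 : 0 < t := by linarith
  set M := t ^ (1 / (s + 1)) with hM
  have hM1 : 1 ≤ M := Real.one_le_rpow ht (by positivity)
  set N := ⌈M⌉₊ with hN
  have hMN : M ≤ N := Nat.le_ceil M
  have hN1 : 1 ≤ N := by
    have : (1 : ℝ) ≤ N := hM1.trans hMN
    exact_mod_cast this
  have hN1' : (1 : ℝ) ≤ N := by exact_mod_cast hN1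
  have hN2 : (N : ℝ) ≤ 2 * M := by
    have := Nat.ceil_lt_add_one (by linarith : 0 ≤ M)
    linarith
  obtain ⟨hgi, hgint⟩ := integral_comp_div_rpow ht0 hs0 hf
  set g : ℝ → ℝ := fun x => f (t / x ^ s) with hg
  set Ψ : ℝ → ℝ := fun x => (t / x ^ (s + 1)) ^ (2 / 3 : ℝ) * G (t / x ^ s) with hΨ
  have hΨ0 : ∀ x ∈ Set.Ioi (N : ℝ), 0 ≤ Ψ x := by
    intro x hx
    have : (0 : ℝ) < x := by linarith [Set.mem_Ioi.1 hx]
    exact mul_nonneg (by positivity) (hG0 _)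
  have hΨm : Measurable Ψ := by
    simp only [hΨ]; fun_prop
  have hΨ0ae : 0 ≤ᵐ[volume.restrict (Set.Ioi (N : ℝ))] Ψ :=
    (ae_restrict_iff' measurableSet_Ioi).2 (Eventually.of_forall hΨ0)
  have hΨi : IntegrableOn Ψ (Set.Ioi (N : ℝ)) := by
    refine ⟨hΨm.aestronglyMeasurable, ?_⟩
    rw [hasFiniteIntegral_iff_ofReal hΨ0ae]
    exact (htail t N ht0 hMN).trans_lt ENNReal.ofReal_lt_top
  have hΨle : ∫ x in Set.Ioi (N : ℝ), Ψ x ≤ C₂ * M := by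
    rw [integral_eq_lintegral_of_nonneg_ae hΨ0ae hΨm.aestronglyMeasurable]
    exact ENNReal.toReal_le_of_le_ofReal (by positivity) (htail t N ht0 hMN)
  -- The exceptional x form a countable set, as x ↦ t / x^s is injective on (0, ∞).
  have hgood : ∀ᵐ x ∂volume, x ∈ Set.Ioi (0 : ℝ) → t / x ^ s ∈ S := by
    have hcount : {x : ℝ | x ∈ Set.Ioi (0 : ℝ) ∧ t / x ^ s ∈ Sᶜ}.Countable := by
      refine Set.MapsTo.countable_of_injOn (f := fun x : ℝ => t / x ^ s) (t := Sᶜ)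
        (fun x hx => hx.2) ?_ hS
      intro x hx y hy hxy
      rw [← div_rpow_leftInverse ht0 hs0 hx.1, ← div_rpow_leftInverse ht0 hs0 hy.1]
      simp only at hxy
      rw [hxy]
    filter_upwards [hcount.ae_notMem volume] with x hx hx0
    by_contra h
    exact hx ⟨hx0, h⟩
  have hgii : ∀ a b : ℝ, 0 ≤ a → a ≤ b → IntervalIntegrable g volume a b := by
    intro a b ha hab
    rw [intervalIntegrable_iff_integrableOn_Ioc_of_le hab]
    exact hgi.mono_set fun x hx => ha.trans_lt hx.1
  have hΨii : ∀ a b : ℝ, (N : ℝ) ≤ a → a ≤ b → IntervalIntegrable Ψ volume a b := by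
    intro a b ha hab
    rw [intervalIntegrable_iff_integrableOn_Ioc_of_le hab]
    exact hΨi.mono_set fun x hx => ha.trans_lt hx.1
  -- The sample at n is compared with g on [n, n + 1]; the weight is evaluated at the integration
  -- variable, so it is averaged.
  have hwin : ∀ n : ℕ, N ≤ n →
      g n ≤ (∫ x in (n : ℝ)..(n + 1 : ℕ), g x) + κ * ∫ x in (n : ℝ)..(n + 1 : ℕ), Ψ x := by
    intro n hn
    have hn' : (N : ℝ) ≤ n := by exact_mod_cast hn
    have hle : (n : ℝ) ≤ (n + 1 : ℕ) := by push_cast; linarith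
    have h1 : ∫ x in (n : ℝ)..(n + 1 : ℕ), g n = g n := by
      rw [intervalIntegral.integral_const]; push_cast; simp
    rw [← h1, ← intervalIntegral.integral_const_mul, ← intervalIntegral.integral_add
      (hgii _ _ (by linarith) hle) ((hΨii _ _ hn' hle).const_mul _)]
    refine intervalIntegral.integral_mono_ae_restrict hle (by simp)
      ((hgii _ _ (by linarith) hle).add ((hΨii _ _ hn' hle).const_mul _)) ?_
    refine (ae_restrict_iff' measurableSet_Icc).2 ?_
    filter_upwards [hgood] with x hx hxI
    have hnS : t / (n : ℝ) ^ s ∈ S := by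
      have := htS (n - 1)
      rwa [Nat.sub_add_cancel (hN1.trans hn)] at this
    have hx0 : 0 < x := by linarith [hxI.1]
    have h2 := hinc _ hnS _ (hx hx0)
    have h3 := div_rpow_sub_div_rpow_le ht0 hs0 (by linarith : (1 : ℝ) ≤ n) hxI.1
      (by simpa using hxI.2)
    have h4 : |t / (n : ℝ) ^ s - t / x ^ s| ^ (2 / 3 : ℝ) ≤
        κ * (t / x ^ (s + 1)) ^ (2 / 3 : ℝ) := by
      rw [hκ, ← Real.mul_rpow (by positivity) (by positivity)]
      gcongr
    have h5 := mul_le_mul_of_nonneg_right h4 (hG0 (t / x ^ s))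
    simp only [hg, hΨ]
    linarith
  have hpart : ∀ m : ℕ, N ≤ m →
      ∑ n ∈ Finset.range m, f (t / ((n + 1 : ℕ) : ℝ) ^ s) ≤
        D * N + (∫ x in (N : ℝ)..(m + 1 : ℕ), g x) + κ * (C₂ * M) := by
    intro m hm
    have e1 : ∑ n ∈ Finset.range m, f (t / ((n + 1 : ℕ) : ℝ) ^ s) =
        ∑ n ∈ Finset.Ico 1 (m + 1), g n := by
      rw [Finset.sum_Ico_eq_sum_range]
      refine Finset.sum_congr (by simp) fun n _ => ?_
      rw [hg, add_comm]
    have e2 : ∑ n ∈ Finset.Ico 1 N, g n ≤ D * N := by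
      calc ∑ n ∈ Finset.Ico 1 N, g n ≤ ∑ n ∈ Finset.Ico 1 N, D :=
            Finset.sum_le_sum fun n _ => hfD _
        _ = (N - 1 : ℕ) * D := by simp
        _ ≤ _ := by
            rw [mul_comm]
            gcongr
            exact Nat.sub_le _ _
    have e3 : ∑ n ∈ Finset.Ico N (m + 1), g n ≤ (∫ x in (N : ℝ)..(m + 1 : ℕ), g x) +
        κ * ∫ x in (N : ℝ)..(m + 1 : ℕ), Ψ x := by
      rw [← intervalIntegral.sum_integral_adjacent_intervals_Ico (a := fun n : ℕ => (n : ℝ))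
          (by omega : N ≤ m + 1), ← intervalIntegral.sum_integral_adjacent_intervals_Ico
          (a := fun n : ℕ => (n : ℝ)) (by omega : N ≤ m + 1), Finset.mul_sum,
          ← Finset.sum_add_distrib]
      · exact Finset.sum_le_sum fun n hn => hwin n (Finset.mem_Ico.1 hn).1
      · intro k hk
        exact hΨii _ _ (by exact_mod_cast hk.1) (by push_cast; linarith)
      · intro k hk
        exact hgii _ _ (by positivity) (by push_cast; linarith)
    have e4 : ∫ x in (N : ℝ)..(m + 1 : ℕ), Ψ x ≤ C₂ * M := by
      have hle : (N : ℝ) ≤ (m + 1 : ℕ) := by exact_mod_cast (by omega : N ≤ m + 1)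
      rw [intervalIntegral.integral_of_le hle]
      exact (setIntegral_mono_set hΨi hΨ0ae
        (Eventually.of_forall fun x hx => hx.1)).trans hΨle
    rw [e1, ← Finset.sum_Ico_consecutive _ hN1 (by omega : N ≤ m + 1)]
    have := mul_le_mul_of_nonneg_left e4 hκ0
    linarith
  have hlim1 := hsum.hasSum.tendsto_sum_nat
  have hlim2 : Tendsto (fun m : ℕ => ∫ x in (N : ℝ)..(m + 1 : ℕ), g x) atTop
      (𝓝 (∫ x in Set.Ioi (N : ℝ), g x)) := by
    refine intervalIntegral_tendsto_integral_Ioi _ (hgi.mono_set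
      (Set.Ioi_subset_Ioi (by positivity))) ?_
    exact tendsto_natCast_atTop_atTop.comp (tendsto_add_atTop_nat 1)
  have hle : ∑' n : ℕ, f (t / ((n + 1 : ℕ) : ℝ) ^ s) ≤
      D * N + (∫ x in Set.Ioi (N : ℝ), g x) + κ * (C₂ * M) := by
    refine le_of_tendsto_of_tendsto hlim1 ((hlim2.const_add _).add_const _) ?_
    filter_upwards [eventually_ge_atTop N] with m hm using hpart m hm
  have hsplit : ∫ x in Set.Ioi (0 : ℝ), g x =
      (∫ x in Set.Ioc (0 : ℝ) N, g x) + ∫ x in Set.Ioi (N : ℝ), g x := by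
    rw [← setIntegral_union (Set.Ioc_disjoint_Ioi le_rfl) measurableSet_Ioi
      (hgi.mono_set Set.Ioc_subset_Ioi_self) (hgi.mono_set (Set.Ioi_subset_Ioi (by positivity))),
      Set.Ioc_union_Ioi_eq_Ioi (by positivity)]
  -- Completing the tail integral to all of (0, ∞) subtracts the head integral, whose possible
  -- negativity is controlled by G.
  have hheadle : -∫ x in Set.Ioc (0 : ℝ) N, g x ≤ C₁ * N := by
    have hGm' : Measurable fun x : ℝ => G (t / x ^ s) := by fun_prop
    have hG0' : 0 ≤ᵐ[volume.restrict (Set.Ioc (0 : ℝ) N)] fun x : ℝ => G (t / x ^ s) :=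
      Eventually.of_forall fun x => hG0 _
    have hbd := hhead t N ht0 (by linarith)
    have hGi : IntegrableOn (fun x : ℝ => G (t / x ^ s)) (Set.Ioc (0 : ℝ) N) := by
      refine ⟨hGm'.aestronglyMeasurable, ?_⟩
      rw [hasFiniteIntegral_iff_ofReal hG0']
      exact hbd.trans_lt ENNReal.ofReal_lt_top
    rw [← integral_neg]
    calc ∫ x in Set.Ioc (0 : ℝ) N, -g x ≤ ∫ x in Set.Ioc (0 : ℝ) N, G (t / x ^ s) := by
          refine setIntegral_mono_ae_restrict (hgi.mono_set Set.Ioc_subset_Ioi_self).neg hGi ?_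
          refine (ae_restrict_iff' measurableSet_Ioc).2 ?_
          filter_upwards [hgood] with x hx hx0 using hfG _ (hx hx0.1)
      _ ≤ C₁ * N := by
          rw [integral_eq_lintegral_of_nonneg_ae hG0' hGm'.aestronglyMeasurable]
          exact ENNReal.toReal_le_of_le_ofReal (by positivity) hbd
  have h6 : D * N ≤ D * (2 * M) := by gcongr
  have h7 : C₁ * N ≤ C₁ * (2 * M) := by gcongr
  linarith

/-! ### Weights controlling the logarithm and its increments -/

/-- For u < c continuity at 0 bounds G by G(0) + 1. For u ≥ c, round up to at most u/T + 1 ≤ u/T +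
u/c whole periods. -/
theorem exists_lintegral_Ioc_le_of_periodic {G : ℝ → ℝ} {T : ℝ} (hT : 0 < T)
    (hper : Function.Periodic G T) (hG0 : ∀ x, 0 ≤ G x) (hint : IntervalIntegrable G volume 0 T)
    (hcont : ContinuousAt G 0) :
    ∃ C : ℝ, 0 ≤ C ∧ ∀ u : ℝ, 0 < u →
      ∫⁻ x in Set.Ioc 0 u, ENNReal.ofReal (G x) ≤ ENNReal.ofReal (C * u) := by
  obtain ⟨c, hc, hcG⟩ : ∃ c > 0, ∀ x : ℝ, |x| < c → G x ≤ G 0 + 1 := by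
    have h := hcont.tendsto.eventually (gt_mem_nhds (lt_add_one (G 0)))
    obtain ⟨c, hc, h⟩ := Metric.eventually_nhds_iff.1 h
    refine ⟨c, hc, fun x hx => (h ?_).le⟩
    simpa using hx
  have hall := hper.intervalIntegrable₀ hT.ne' hint
  set I := ∫ x in (0 : ℝ)..T, G x
  have hI : 0 ≤ I := intervalIntegral.integral_nonneg hT.le fun x _ => hG0 x
  have hG00 := hG0 0
  refine ⟨G 0 + 1 + (1 / T + 1 / c) * I, by positivity, fun u hu => ?_⟩
  rcases lt_or_ge u c with h | h
  · calc ∫⁻ x in Set.Ioc 0 u, ENNReal.ofReal (G x)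
        ≤ ∫⁻ _ in Set.Ioc 0 u, ENNReal.ofReal (G 0 + 1) := by
          refine setLIntegral_mono' measurableSet_Ioc fun x hx => ?_
          refine ENNReal.ofReal_le_ofReal (hcG x ?_)
          rw [abs_of_pos hx.1]
          exact hx.2.trans_lt h
      _ = ENNReal.ofReal ((G 0 + 1) * u) := by
          rw [setLIntegral_const, Real.volume_Ioc, sub_zero, ENNReal.ofReal_mul (by positivity)]
      _ ≤ _ := by
          refine ENNReal.ofReal_le_ofReal (mul_le_mul_of_nonneg_right ?_ hu.le)
          have : 0 ≤ (1 / T + 1 / c) * I := by positivity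
          linarith
  · set n := ⌈u / T⌉₊ with hn
    have hn1 : u ≤ n * T := by
      rw [← div_le_iff₀ hT]; exact Nat.le_ceil _
    have hn2 : (n : ℝ) ≤ u / T + 1 := (Nat.ceil_lt_add_one (by positivity)).le
    have hn0 : 0 ≤ n * T := by positivity
    have hnI : ∫ x in (0 : ℝ)..(n * T), G x = n * I := by
      have := hper.intervalIntegral_add_zsmul_eq n 0 hall
      simpa using this
    calc ∫⁻ x in Set.Ioc 0 u, ENNReal.ofReal (G x)
        ≤ ∫⁻ x in Set.Ioc 0 (n * T), ENNReal.ofReal (G x) :=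
          lintegral_mono_set (Set.Ioc_subset_Ioc_right hn1)
      _ = ENNReal.ofReal (n * I) := by
          rw [← hnI, intervalIntegral.integral_of_le hn0, ofReal_integral_eq_lintegral_ofReal]
          · exact (intervalIntegrable_iff_integrableOn_Ioc_of_le hn0).1 (hall _ _)
          · exact Eventually.of_forall fun x => hG0 x
      _ ≤ _ := by
          refine ENNReal.ofReal_le_ofReal ?_
          have h1 : 1 ≤ u / c := (one_le_div hc).2 h
          calc n * I ≤ (u / T + u / c) * I := by gcongr; linarith
            _ = (1 / T + 1 / c) * I * u := by ring
            _ ≤ _ := by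
              have : 0 ≤ (G 0 + 1) * u := by positivity
              linarith

/-- On [0, π/2], sin x ≥ 2x/π reduces this to x^(-2/3); evenness and π-periodicity spread it. -/
theorem intervalIntegrable_abs_sin_rpow (a b : ℝ) :
    IntervalIntegrable (fun x => |Real.sin x| ^ (-(2 / 3) : ℝ)) volume a b := by
  have hpi := Real.pi_pos
  have hper : Function.Periodic (fun x => |Real.sin x| ^ (-(2 / 3) : ℝ)) Real.pi := by
    intro x
    simp only [Real.sin_add_pi, abs_neg]
  have hhalf : IntervalIntegrable (fun x => |Real.sin x| ^ (-(2 / 3) : ℝ)) volume 0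
      (Real.pi / 2) := by
    have h1 : IntervalIntegrable (fun x : ℝ => (2 / Real.pi) ^ (-(2 / 3) : ℝ) *
        x ^ (-(2 / 3) : ℝ)) volume 0 (Real.pi / 2) :=
      (intervalIntegral.intervalIntegrable_rpow' (by norm_num)).const_mul _
    refine h1.mono_fun (Measurable.aestronglyMeasurable (by fun_prop)) ?_
    refine (ae_restrict_iff' measurableSet_uIoc).2 (Eventually.of_forall fun x hx => ?_)
    rw [Set.uIoc_of_le (by positivity)] at hx
    have hx0 : 0 < x := hx.1
    beta_reduce
    rw [Real.norm_of_nonneg (by positivity), Real.norm_of_nonneg (by positivity),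
      ← Real.mul_rpow (by positivity) hx0.le]
    refine Real.rpow_le_rpow_of_nonpos (by positivity) ?_ (by norm_num)
    exact (Real.mul_le_sin hx0.le hx.2).trans (le_abs_self _)
  have hneg : IntervalIntegrable (fun x => |Real.sin x| ^ (-(2 / 3) : ℝ)) volume 0
      (-(Real.pi / 2)) := by
    have := (IntervalIntegrable.iff_comp_neg (f := fun x => |Real.sin x| ^ (-(2 / 3) : ℝ))
      (a := 0) (b := Real.pi / 2)).1 hhalf
    simpa using this
  refine hper.intervalIntegrable (t := -(Real.pi / 2)) hpi.ne' ?_ a b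
  have : -(Real.pi / 2) + Real.pi = Real.pi / 2 := by ring
  rw [this]
  exact hneg.symm.trans hhalf

theorem log_one_add_le_rpow {z : ℝ} (hz : 0 ≤ z) :
    Real.log (1 + z) ≤ 3 / 2 * z ^ (2 / 3 : ℝ) := by
  have h1 : (1 + z) ^ (2 / 3 : ℝ) ≤ 1 + z ^ (2 / 3 : ℝ) := by
    simpa using Real.rpow_add_le_add_rpow zero_le_one hz (by norm_num : (0 : ℝ) ≤ 2 / 3)
      (by norm_num)
  have h2 := Real.log_le_log (by positivity) h1
  rw [Real.log_rpow (by positivity)] at h2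
  have h3 := Real.log_le_sub_one_of_pos (by positivity : 0 < 1 + z ^ (2 / 3 : ℝ))
  linarith

/-- Since |A| / |B| ≤ 1 + d / |B|, the bound blows up only when B is small, never when A is: the
source of the one-sided estimate. -/
theorem log_abs_sub_log_abs_le {A B d : ℝ} (hA : A ≠ 0) (hB : B ≠ 0) (h : |A - B| ≤ d) :
    Real.log |A| - Real.log |B| ≤ d ^ (2 / 3 : ℝ) * (3 / 2 * |B| ^ (-(2 / 3) : ℝ)) := by
  have hA' := abs_pos.2 hA
  have hB' := abs_pos.2 hB
  have hd : 0 ≤ d := (abs_nonneg _).trans h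
  have h1 : |A| / |B| ≤ 1 + d / |B| := by
    rw [div_le_iff₀ hB', add_mul, div_mul_cancel₀ _ hB'.ne']
    have := abs_sub_abs_le_abs_sub A B
    linarith
  rw [← Real.log_div hA'.ne' hB'.ne']
  refine (Real.log_le_log (by positivity) h1).trans ?_
  refine (log_one_add_le_rpow (by positivity)).trans (le_of_eq ?_)
  rw [Real.div_rpow hd hB'.le, Real.rpow_neg hB'.le]
  ring

theorem neg_log_abs_le (B : ℝ) : -Real.log |B| ≤ 3 / 2 * |B| ^ (-(2 / 3) : ℝ) := by
  have h := Real.log_le_rpow_div (inv_nonneg.2 (abs_nonneg B)) (by norm_num : (0 : ℝ) < 2 / 3)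
  rw [Real.log_inv, Real.inv_rpow (abs_nonneg B), ← Real.rpow_neg (abs_nonneg B)] at h
  linarith

/-- The weight `|sin ((x + c) / 2)| ^ (-2/3)`. -/
noncomputable def sinWeight (c x : ℝ) : ℝ := |Real.sin ((x + c) / 2)| ^ (-(2 / 3) : ℝ)

theorem sinWeight_nonneg (c x : ℝ) : 0 ≤ sinWeight c x := by
  unfold sinWeight; positivity

theorem measurable_sinWeight (c : ℝ) : Measurable (sinWeight c) := by
  unfold sinWeight; fun_prop

theorem periodic_sinWeight (c : ℝ) : Function.Periodic (sinWeight c) (2 * Real.pi) := by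
  intro x
  have : (x + 2 * Real.pi + c) / 2 = (x + c) / 2 + Real.pi := by ring
  simp only [sinWeight, this, Real.sin_add_pi, abs_neg]

theorem intervalIntegrable_sinWeight (c : ℝ) :
    IntervalIntegrable (sinWeight c) volume 0 (2 * Real.pi) := by
  have h1 := ((intervalIntegrable_abs_sin_rpow (c / 2) (Real.pi + c / 2)).comp_add_right
    (c / 2)).comp_mul_right (c := 1 / 2)
  convert! h1 using 1
  · ext x
    simp only [sinWeight]
    congr 3; ring
  · ring
  · ring

theorem continuousAt_sinWeight {c : ℝ} (hc : Real.sin (c / 2) ≠ 0) :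
    ContinuousAt (sinWeight c) 0 := by
  unfold sinWeight
  refine ContinuousAt.rpow_const (by fun_prop) (Or.inl ?_)
  simpa using hc

theorem countable_sin_half_zeros (c : ℝ) : {x : ℝ | Real.sin ((x + c) / 2) = 0}.Countable := by
  refine (Set.countable_range (fun n : ℤ => 2 * (n * Real.pi) - c)).mono ?_
  intro x hx
  obtain ⟨n, hn⟩ := Real.sin_eq_zero_iff.1 hx
  exact ⟨n, by simp only; rw [hn]; ring⟩

/-- The logarithm `ln |1 - p + p cos x|`. -/
noncomputable def logFactor (p x : ℝ) : ℝ := Real.log |1 - p + p * Real.cos x|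

theorem abs_factor_le_one {p : ℝ} (hp : p ∈ Set.Ioc (0 : ℝ) 1) (x : ℝ) :
    |1 - p + p * Real.cos x| ≤ 1 := by
  have h1 := Real.cos_le_one x
  have h2 := Real.neg_one_le_cos x
  rw [abs_le]
  constructor <;> nlinarith [hp.1, hp.2]

theorem logFactor_nonpos {p : ℝ} (hp : p ∈ Set.Ioc (0 : ℝ) 1) (x : ℝ) : logFactor p x ≤ 0 :=
  Real.log_nonpos (abs_nonneg _) (abs_factor_le_one hp x)

theorem abs_factor_sub_le {p : ℝ} (hp : p ∈ Set.Ioc (0 : ℝ) 1) (x y : ℝ) :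
    |(1 - p + p * Real.cos x) - (1 - p + p * Real.cos y)| ≤ |x - y| := by
  have h : (1 - p + p * Real.cos x) - (1 - p + p * Real.cos y) = p * (Real.cos x - Real.cos y) := by
    ring
  rw [h, abs_mul, abs_of_pos hp.1]
  have := Real.abs_cos_sub_cos_le x y
  nlinarith [hp.2, abs_nonneg (Real.cos x - Real.cos y)]

theorem one_half_le_factor {p x : ℝ} (hp : p ∈ Set.Ioc (0 : ℝ) 1) (hx : |x| ≤ 1) :
    1 / 2 ≤ 1 - p + p * Real.cos x := by
  have h := one_sub_cos_le_sq x
  have h1 : x ^ 2 ≤ 1 := (sq_le_one_iff_abs_le_one x).2 hx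
  nlinarith [hp.1, hp.2]

/-- For the factor q ≥ 1/2, -ln q ≤ (1 - q)/q ≤ 2(1 - q). This quadratic smallness gives
integrability at 0 when 1/s < 2. -/
theorem neg_logFactor_le_sq {p x : ℝ} (hp : p ∈ Set.Ioc (0 : ℝ) 1) (hx : |x| ≤ 1) :
    -logFactor p x ≤ x ^ 2 := by
  have hq := one_half_le_factor hp hx
  have h := one_sub_cos_le_sq x
  have h0 := sub_nonneg.2 (Real.cos_le_one x)
  set q := 1 - p + p * Real.cos x with hqd
  have hq0 : 0 < q := by linarith
  rw [logFactor, ← hqd, abs_of_pos hq0, ← Real.log_inv]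
  refine (Real.log_le_sub_one_of_pos (by positivity)).trans ?_
  rw [inv_eq_one_div, div_sub_one hq0.ne', div_le_iff₀ hq0]
  have h5 : 1 - q ≤ x ^ 2 / 2 := by nlinarith [hp.1, hp.2]
  nlinarith [sq_nonneg x]

/-- A weight which bounds `-logFactor` and its increments from above. -/
structure IsLogWeight (p : ℝ) (G : ℝ → ℝ) (S : Set ℝ) (C : ℝ) : Prop where
  nonneg_const : 0 ≤ C
  countable_compl : Sᶜ.Countable
  measurable : Measurable G
  nonneg : ∀ x, 0 ≤ G x
  lintegral_le : ∀ u : ℝ, 0 < u →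
    ∫⁻ x in Set.Ioc 0 u, ENNReal.ofReal (G x) ≤ ENNReal.ofReal (C * u)
  mem_of_ne_zero : ∀ x, 1 - p + p * Real.cos x ≠ 0 → x ∈ S
  neg_le : ∀ x ∈ S, -logFactor p x ≤ G x
  sub_le : ∀ x ∈ S, ∀ y ∈ S, logFactor p x - logFactor p y ≤ |x - y| ^ (2 / 3 : ℝ) * G y

/-- The factor never drops below 1 - 2p > 0. -/
theorem isLogWeight_const {p : ℝ} (hp : p ∈ Set.Ioc (0 : ℝ) 1) (hp2 : p < 1 / 2) :
    IsLogWeight p (fun _ => 3 / 2 * (1 - 2 * p) ^ (-(2 / 3) : ℝ)) Set.univ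
      (3 / 2 * (1 - 2 * p) ^ (-(2 / 3) : ℝ)) := by
  have hδ : 0 < 1 - 2 * p := by linarith
  have hq : ∀ x, 1 - 2 * p ≤ |1 - p + p * Real.cos x| := by
    intro x
    refine le_trans ?_ (le_abs_self _)
    nlinarith [hp.1, Real.neg_one_le_cos x]
  have hq0 : ∀ x, 1 - p + p * Real.cos x ≠ 0 := fun x => abs_pos.1 (hδ.trans_le (hq x))
  have hG : ∀ x, 3 / 2 * |1 - p + p * Real.cos x| ^ (-(2 / 3) : ℝ) ≤
      3 / 2 * (1 - 2 * p) ^ (-(2 / 3) : ℝ) := by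
    intro x
    exact mul_le_mul_of_nonneg_left (Real.rpow_le_rpow_of_nonpos hδ (hq x) (by norm_num))
      (by norm_num)
  refine ⟨by positivity, by simp, measurable_const, fun _ => by positivity, ?_,
    fun _ _ => trivial, ?_, ?_⟩
  · intro u hu
    rw [setLIntegral_const, Real.volume_Ioc, sub_zero, ← ENNReal.ofReal_mul (by positivity)]
  · exact fun x _ => (neg_log_abs_le _).trans (hG x)
  · intro x _ y _
    refine (log_abs_sub_log_abs_le (hq0 x) (hq0 y) (abs_factor_sub_le hp x y)).trans ?_
    exact mul_le_mul_of_nonneg_left (hG y) (by positivity)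

/-- With cos θ = 1 - 1/p the factor is -2p sin((x+θ)/2) sin((x-θ)/2), so its logarithm splits into
two log-sines, each with its own weight. The double zero at p = 1/2 (θ = π) needs no extra care, and
θ > 0 keeps the weight continuous at 0. -/
theorem exists_isLogWeight_of_one_half_le {p : ℝ} (hp : p ∈ Set.Ioc (0 : ℝ) 1)
    (hp2 : 1 / 2 ≤ p) : ∃ G S C, IsLogWeight p G S C := by
  have hp0 := hp.1
  have hpi := Real.pi_pos
  set θ := Real.arccos (1 - 1 / p) with hθ
  have hinv : 1 / p ≤ 2 := by rw [div_le_iff₀ hp0]; linarith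
  have hinv0 : 0 < 1 / p := by positivity
  have hcosθ : Real.cos θ = 1 - 1 / p := Real.cos_arccos (by linarith) (by linarith)
  have hθpos : 0 < θ := Real.arccos_pos.2 (by linarith)
  have hθle : θ ≤ Real.pi := Real.arccos_le_pi _
  have hsinθ : Real.sin (θ / 2) ≠ 0 :=
    (Real.sin_pos_of_pos_of_lt_pi (by linarith) (by linarith)).ne'
  have hsinθ' : Real.sin (-θ / 2) ≠ 0 := by
    rw [neg_div, Real.sin_neg]; exact neg_ne_zero.2 hsinθ
  have hq : ∀ x, 1 - p + p * Real.cos x =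
      -2 * p * (Real.sin ((x + θ) / 2) * Real.sin ((x + -θ) / 2)) := by
    intro x
    have h1 := Real.cos_sub_cos x θ
    rw [hcosθ] at h1
    have h2 : 1 - p + p * Real.cos x = p * (Real.cos x - (1 - 1 / p)) := by field_simp; ring
    rw [h2, h1, ← sub_eq_add_neg]; ring
  set S : Set ℝ := {x | Real.sin ((x + θ) / 2) ≠ 0 ∧ Real.sin ((x + -θ) / 2) ≠ 0} with hS
  have hlog : ∀ x ∈ S, logFactor p x = Real.log (2 * p) + (Real.log |Real.sin ((x + θ) / 2)| +
      Real.log |Real.sin ((x + -θ) / 2)|) := by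
    intro x hx
    rw [logFactor, hq x, abs_mul, abs_mul, abs_mul, abs_neg, abs_of_pos hp0, abs_two,
      Real.log_mul (by positivity) (mul_ne_zero (abs_ne_zero.2 hx.1) (abs_ne_zero.2 hx.2)),
      Real.log_mul (abs_ne_zero.2 hx.1) (abs_ne_zero.2 hx.2)]
  have hsin : ∀ c x y : ℝ, |Real.sin ((x + c) / 2) - Real.sin ((y + c) / 2)| ≤ |x - y| := by
    intro c x y
    refine (Real.abs_sin_sub_sin_le _ _).trans ?_
    have : (x + c) / 2 - (y + c) / 2 = (x - y) / 2 := by ring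
    rw [this, abs_div, abs_two]
    linarith [abs_nonneg (x - y)]
  obtain ⟨C, hC, hlin⟩ := exists_lintegral_Ioc_le_of_periodic
    (G := fun x => 3 / 2 * (sinWeight θ x + sinWeight (-θ) x)) (T := 2 * Real.pi) (by positivity)
    (fun x => by simp only [periodic_sinWeight θ x, periodic_sinWeight (-θ) x])
    (fun x => by have := sinWeight_nonneg θ x; have := sinWeight_nonneg (-θ) x; positivity)
    (((intervalIntegrable_sinWeight θ).add (intervalIntegrable_sinWeight (-θ))).const_mul _)
    (((continuousAt_sinWeight hsinθ).add (continuousAt_sinWeight hsinθ')).const_mul _)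
  refine ⟨fun x => 3 / 2 * (sinWeight θ x + sinWeight (-θ) x), S, C, hC, ?_, ?_, ?_, hlin, ?_, ?_, ?_⟩
  · refine ((countable_sin_half_zeros θ).union (countable_sin_half_zeros (-θ))).mono ?_
    intro x hx
    by_contra h
    simp only [Set.mem_union, Set.mem_ofPred_eq, not_or] at h
    exact hx h
  · exact ((measurable_sinWeight θ).add (measurable_sinWeight (-θ))).const_mul _
  · intro x
    have := sinWeight_nonneg θ x
    have := sinWeight_nonneg (-θ) x
    positivity
  · intro x hx
    rw [hq x] at hx
    have := right_ne_zero_of_mul hx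
    exact ⟨left_ne_zero_of_mul this, right_ne_zero_of_mul this⟩
  · intro x hx
    have h1 := neg_log_abs_le (Real.sin ((x + θ) / 2))
    have h2 := neg_log_abs_le (Real.sin ((x + -θ) / 2))
    have h3 : 0 ≤ Real.log (2 * p) := Real.log_nonneg (by linarith)
    rw [hlog x hx]
    unfold sinWeight
    linarith
  · intro x hx y hy
    have h1 := log_abs_sub_log_abs_le hx.1 hy.1 (hsin θ x y)
    have h2 := log_abs_sub_log_abs_le hx.2 hy.2 (hsin (-θ) x y)
    rw [hlog x hx, hlog y hy]
    unfold sinWeight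
    linarith

theorem exists_isLogWeight {p : ℝ} (hp : p ∈ Set.Ioc (0 : ℝ) 1) : ∃ G S C, IsLogWeight p G S C := by
  rcases lt_or_ge p (1 / 2) with h | h
  · exact ⟨_, _, _, isLogWeight_const hp h⟩
  · exact exists_isLogWeight_of_one_half_le hp h

/-! ### Convergence of the integral, the product and its logarithm -/

theorem integrableOn_integrandC {p s : ℝ} (hp : p ∈ Set.Ioc (0 : ℝ) 1) (hs : 1 / 2 < s) :
    IntegrableOn (integrandC p s) (Set.Ioi 0) := by
  obtain ⟨G, S, C, hG⟩ := exists_isLogWeight hp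
  have hs0 : 0 < s := by linarith
  have h0 : 0 < 1 / s := by positivity
  have h2 : 1 / s < 2 := by
    rw [div_lt_iff₀ (by linarith)]; linarith
  have hm : Measurable (integrandC p s) := by
    unfold integrandC; fun_prop
  have hnorm : ∀ x : ℝ, 0 < x → ‖integrandC p s x‖ = -logFactor p x * (1 / x ^ (1 + 1 / s)) := by
    intro x hx
    have h : integrandC p s x = logFactor p x * (1 / x ^ (1 + 1 / s)) := rfl
    rw [h, norm_mul, Real.norm_of_nonpos (logFactor_nonpos hp x),
      Real.norm_of_nonneg (by positivity)]
  rw [← Set.Ioc_union_Ioi_eq_Ioi (zero_le_one' ℝ)]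
  refine IntegrableOn.union ?_ ?_
  · have h1 : IntegrableOn (fun x : ℝ => x ^ (1 - 1 / s)) (Set.Ioc 0 1) := by
      rw [← intervalIntegrable_iff_integrableOn_Ioc_of_le zero_le_one]
      exact intervalIntegral.intervalIntegrable_rpow' (by linarith)
    refine h1.mono' hm.aestronglyMeasurable ?_
    refine (ae_restrict_iff' measurableSet_Ioc).2 (Eventually.of_forall fun x hx => ?_)
    have hx0 : 0 < x := hx.1
    rw [hnorm x hx0]
    have hsq := neg_logFactor_le_sq hp (by rw [abs_of_pos hx0]; exact hx.2 : |x| ≤ 1)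
    calc -logFactor p x * (1 / x ^ (1 + 1 / s)) ≤ x ^ 2 * (1 / x ^ (1 + 1 / s)) := by gcongr
      _ = x ^ (1 - 1 / s) := by
        rw [← Real.rpow_two, mul_one_div, ← Real.rpow_sub hx0]
        congr 1; ring
  · obtain ⟨C', -, h⟩ := exists_lintegral_Ici_rpow_mul_le hG.nonneg_const hG.lintegral_le
      (e := -(1 + 1 / s)) (by linarith)
    have h1 : IntegrableOn (fun x : ℝ => x ^ (-(1 + 1 / s)) * G x) (Set.Ioi 1) := by
      have hmG := hG.measurable
      refine ⟨Measurable.aestronglyMeasurable (by fun_prop), ?_⟩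
      rw [hasFiniteIntegral_iff_ofReal]
      · exact ((lintegral_mono_set Set.Ioi_subset_Ici_self).trans (h 1 one_pos)).trans_lt
          ENNReal.ofReal_lt_top
      · refine (ae_restrict_iff' measurableSet_Ioi).2 (Eventually.of_forall fun x hx => ?_)
        have hx0 : (0 : ℝ) < x := zero_lt_one.trans hx
        exact mul_nonneg (by positivity) (hG.nonneg x)
    refine h1.mono' hm.aestronglyMeasurable ?_
    refine (ae_restrict_iff' measurableSet_Ioi).2 ?_
    filter_upwards [hG.countable_compl.ae_notMem volume] with x hxS hx
    have hx0 : (0 : ℝ) < x := zero_lt_one.trans hx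
    rw [hnorm x hx0, mul_comm, Real.rpow_neg hx0.le, ← one_div]
    exact mul_le_mul_of_nonneg_left (hG.neg_le x (not_not.1 hxS)) (by positivity)

theorem summable_sq_div_rpow {s : ℝ} (hs : 1 / 2 < s) :
    Summable (fun n : ℕ => (1 / ((n + 1 : ℕ) : ℝ) ^ s) ^ 2) := by
  have h : Summable (fun n : ℕ => 1 / (n : ℝ) ^ (s * 2)) :=
    Real.summable_one_div_nat_rpow.2 (by linarith)
  refine ((summable_nat_add_iff 1).2 h).congr fun n => ?_
  rw [div_pow, one_pow, Real.rpow_mul (by positivity), Real.rpow_two]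

theorem summable_factor_sub_one {p s : ℝ} (hp : p ∈ Set.Ioc (0 : ℝ) 1) (hs : 1 / 2 < s) (t : ℝ) :
    Summable (fun n : ℕ => factor p s t (n + 1) - 1) := by
  refine Summable.of_norm_bounded ((summable_sq_div_rpow hs).mul_left (t ^ 2)) fun n => ?_
  have h := one_sub_cos_le_sq (t / ((n + 1 : ℕ) : ℝ) ^ s)
  have h0 := sub_nonneg.2 (Real.cos_le_one (t / ((n + 1 : ℕ) : ℝ) ^ s))
  have h1 : factor p s t (n + 1) - 1 = -(p * (1 - Real.cos (t / ((n + 1 : ℕ) : ℝ) ^ s))) := by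
    unfold factor; ring
  rw [h1, norm_neg, Real.norm_of_nonneg (mul_nonneg hp.1.le h0), ← mul_pow, mul_one_div]
  nlinarith [hp.1, hp.2, sq_nonneg (t / ((n + 1 : ℕ) : ℝ) ^ s)]

theorem multipliable_factor {p s : ℝ} (hp : p ∈ Set.Ioc (0 : ℝ) 1) (hs : 1 / 2 < s) (t : ℝ) :
    Multipliable (fun n : ℕ => factor p s t (n + 1)) := by
  have h := Real.multipliable_one_add_of_summable (summable_factor_sub_one hp hs t)
  simpa using h

theorem summable_logFactor {p s : ℝ} (hp : p ∈ Set.Ioc (0 : ℝ) 1) (hs : 1 / 2 < s) (t : ℝ) :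
    Summable (fun n : ℕ => logFactor p (t / ((n + 1 : ℕ) : ℝ) ^ s)) := by
  have h := Real.summable_log_one_add_of_summable (summable_factor_sub_one hp hs t)
  refine h.congr fun n => ?_
  rw [add_sub_cancel, logFactor, Real.log_abs, factor]

/-- The sum `∑_{n ≥ 1} ln |1 - p + p cos (t / n ^ s)|`. -/
noncomputable def logSum (p s t : ℝ) : ℝ := ∑' n : ℕ, logFactor p (t / ((n + 1 : ℕ) : ℝ) ^ s)

/-- Vanishing factors must be excluded: with `Real.log 0 = 0` the sum would ignore them. -/
theorem abs_Cl_eq_exp_logSum {p s : ℝ} (hp : p ∈ Set.Ioc (0 : ℝ) 1) (hs : 1 / 2 < s) {t : ℝ}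
    (h : ∀ n : ℕ, factor p s t (n + 1) ≠ 0) : |Cl p s t| = Real.exp (logSum p s t) := by
  rw [Cl, (multipliable_factor hp hs t).abs_tprod, logSum, ← Real.rexp_tsum_eq_tprod]
  · rfl
  · exact fun n => abs_pos.2 (h n)
  · exact summable_logFactor hp hs t

theorem Cl_abs (p s t : ℝ) : Cl p s |t| = Cl p s t := by
  rcases abs_choice t with h | h
  · rw [h]
  · rw [h]
    simp only [Cl, factor, neg_div, Real.cos_neg]

/-- Covers t ≤ 1, where the comparison does not apply: there t² and t^(1/s) are both at most
t^(1/(s+1)). -/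
theorem abs_logSum_add_le_of_le_one {p s : ℝ} (hp : p ∈ Set.Ioc (0 : ℝ) 1) (hs : 1 / 2 < s) {t : ℝ}
    (ht0 : 0 ≤ t) (ht1 : t ≤ 1) :
    |logSum p s t + coeffC p s * t ^ (1 / s)| ≤
      ((∑' n : ℕ, (1 / ((n + 1 : ℕ) : ℝ) ^ s) ^ 2) + |coeffC p s|) * t ^ (1 / (s + 1)) := by
  have hs0 : 0 < s := by linarith
  have harg : ∀ n : ℕ, |t / ((n + 1 : ℕ) : ℝ) ^ s| ≤ 1 := by
    intro n
    have h1 : (1 : ℝ) ≤ ((n + 1 : ℕ) : ℝ) ^ s := Real.one_le_rpow (by simp) hs0.le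
    rw [abs_of_nonneg (by positivity), div_le_one (by positivity)]
    linarith
  have h1 : |logSum p s t| ≤ t ^ 2 * ∑' n : ℕ, (1 / ((n + 1 : ℕ) : ℝ) ^ s) ^ 2 := by
    have hsum := summable_logFactor hp hs t
    rw [logSum, ← abs_neg, ← tsum_neg, ← tsum_mul_left, abs_of_nonneg
      (tsum_nonneg fun n => neg_nonneg.2 (logFactor_nonpos hp _))]
    refine hsum.neg.tsum_le_tsum (fun n => ?_) ((summable_sq_div_rpow hs).mul_left _)
    rw [← mul_pow, mul_one_div]
    exact neg_logFactor_le_sq hp (harg n)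
  have hZ : 0 ≤ ∑' n : ℕ, (1 / ((n + 1 : ℕ) : ℝ) ^ s) ^ 2 := tsum_nonneg fun n => by positivity
  have h2 : t ^ 2 ≤ t ^ (1 / (s + 1)) := by
    rw [← Real.rpow_two]
    refine Real.rpow_le_rpow_of_exponent_ge' ht0 ht1 (by positivity) ?_
    rw [div_le_iff₀ (by positivity)]; linarith
  have h3 : t ^ (1 / s) ≤ t ^ (1 / (s + 1)) := by
    refine Real.rpow_le_rpow_of_exponent_ge' ht0 ht1 (by positivity) ?_
    gcongr
    linarith
  refine (abs_add_le _ _).trans ?_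
  rw [abs_mul, abs_of_nonneg (Real.rpow_nonneg ht0 (1 / s)), add_mul]
  refine add_le_add (h1.trans ?_) (by gcongr)
  rw [mul_comm]
  gcongr

/-! ### Trend and fluctuation -/

theorem trend_eq (p s t : ℝ) :
    1 / s * t ^ (1 / s) * ∫ ξ in Set.Ioi (0 : ℝ), logFactor p ξ * (1 / ξ ^ (1 + 1 / s)) =
      -(coeffC p s * t ^ (1 / s)) := by
  have h : coeffC p s = -(1 / s) *
    ∫ ξ in Set.Ioi (0 : ℝ), logFactor p ξ * (1 / ξ ^ (1 + 1 / s)) := rfl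
  rw [h]; ring

theorem exists_logSum_add_le {p s : ℝ} (hp : p ∈ Set.Ioc (0 : ℝ) 1) (hs : 1 / 2 < s) :
    ∃ K : ℝ, 0 ≤ K ∧ ∀ t : ℝ, 0 ≤ t → (∀ n : ℕ, factor p s t (n + 1) ≠ 0) →
      logSum p s t + coeffC p s * t ^ (1 / s) ≤ K * t ^ (1 / (s + 1)) := by
  obtain ⟨G, S, C, hG⟩ := exists_isLogWeight hp
  obtain ⟨K, hK, h⟩ := exists_tsum_le_integral_add (f := logFactor p) (D := 0) hs hG.nonneg_const
    le_rfl hG.countable_compl hG.measurable hG.nonneg hG.lintegral_le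
    (integrableOn_integrandC hp hs) (logFactor_nonpos hp) hG.neg_le hG.sub_le
  refine ⟨max K ((∑' n : ℕ, (1 / ((n + 1 : ℕ) : ℝ) ^ s) ^ 2) + |coeffC p s|),
    le_max_of_le_left hK, fun t ht hne => ?_⟩
  rcases le_or_gt t 1 with h1 | h1
  · refine (le_abs_self _).trans ((abs_logSum_add_le_of_le_one hp hs ht h1).trans ?_)
    gcongr
    exact le_max_right _ _
  · have h2 := h t h1.le (fun n => hG.mem_of_ne_zero _ (hne n)) (summable_logFactor hp hs t)
    rw [trend_eq] at h2
    have h3 : K * t ^ (1 / (s + 1)) ≤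
        max K ((∑' n : ℕ, (1 / ((n + 1 : ℕ) : ℝ) ^ s) ^ 2) + |coeffC p s|) * t ^ (1 / (s + 1)) := by
      gcongr
      exact le_max_left _ _
    unfold logSum
    linarith

theorem exists_neg_logSum_add_le {p s : ℝ} (hp : p ∈ Set.Ioc (0 : ℝ) 1) (hs : 1 / 2 < s)
    (hp2 : p < 1 / 2) :
    ∃ K : ℝ, 0 ≤ K ∧ ∀ t : ℝ, 0 ≤ t →
      -(logSum p s t + coeffC p s * t ^ (1 / s)) ≤ K * t ^ (1 / (s + 1)) := by
  have hG := isLogWeight_const hp hp2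
  -- The comparison applies to the negated logarithm because the constant weight also bounds it from
  -- above and makes the increment bound symmetric in x and y.
  obtain ⟨K, hK, h⟩ := exists_tsum_le_integral_add (f := fun x => -logFactor p x) hs
    hG.nonneg_const hG.nonneg_const hG.countable_compl hG.measurable hG.nonneg hG.lintegral_le
    (by simp_rw [neg_mul]; exact (integrableOn_integrandC hp hs).neg)
    (fun x => hG.neg_le x trivial)
    (fun x _ => by
      rw [neg_neg]
      exact (logFactor_nonpos hp x).trans (hG.nonneg x))
    (fun x _ y _ => by
      have := hG.sub_le y trivial x trivial
      rw [abs_sub_comm] at this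
      linarith)
  refine ⟨max K ((∑' n : ℕ, (1 / ((n + 1 : ℕ) : ℝ) ^ s) ^ 2) + |coeffC p s|),
    le_max_of_le_left hK, fun t ht => ?_⟩
  rcases le_or_gt t 1 with h1 | h1
  · refine (neg_le_abs _).trans ((abs_logSum_add_le_of_le_one hp hs ht h1).trans ?_)
    gcongr
    exact le_max_right _ _
  · have h2 := h t h1.le (fun n => trivial) (summable_logFactor hp hs t).neg
    simp_rw [neg_mul] at h2
    rw [integral_neg, mul_neg, trend_eq, tsum_neg] at h2
    have h3 : K * t ^ (1 / (s + 1)) ≤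
        max K ((∑' n : ℕ, (1 / ((n + 1 : ℕ) : ℝ) ^ s) ^ 2) + |coeffC p s|) * t ^ (1 / (s + 1)) := by
      gcongr
      exact le_max_left _ _
    unfold logSum
    linarith

theorem factor_pos {p : ℝ} (hp : p ∈ Set.Ioc (0 : ℝ) 1) (hp2 : p < 1 / 2) (s t : ℝ) (n : ℕ) :
    0 < factor p s t n := by
  unfold factor
  nlinarith [hp.1, Real.neg_one_le_cos (t / (n : ℝ) ^ s)]

/-- The absolute value drops because the product is a limit of positive partial products. -/
theorem Cl_eq_exp_logSum {p s : ℝ} (hp : p ∈ Set.Ioc (0 : ℝ) 1) (hs : 1 / 2 < s)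
    (hp2 : p < 1 / 2) (t : ℝ) : Cl p s t = Real.exp (logSum p s t) := by
  rw [← abs_Cl_eq_exp_logSum hp hs fun n => (factor_pos hp hp2 s t (n + 1)).ne', abs_of_nonneg]
  have h : Tendsto (fun m => ∏ n ∈ Finset.range m, factor p s t (n + 1)) atTop (𝓝 (Cl p s t)) :=
    (multipliable_factor hp hs t).hasProd.tendsto_prod_nat
  exact ge_of_tendsto' h fun m => Finset.prod_nonneg fun n _ => (factor_pos hp hp2 s t (n + 1)).le

theorem exists_fluctuation {p s : ℝ} (hp : p ∈ Set.Ioc (0 : ℝ) 1) (hs : 1 / 2 < s) :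
    ∃ F : ℝ → ℝ, ∃ K : ℝ, 0 < K ∧
      (∀ t : ℝ, Cl p s t = Real.exp (-coeffC p s * |t| ^ (1 / s)) * F |t|) ∧
      (∀ t : ℝ, |F (|t|)| ≤ Real.exp (K * |t| ^ (1 / (s + 1)))) ∧
      (p < 1 / 2 → ∀ t : ℝ, 0 < F |t| ∧ |Real.log (F |t|)| ≤ K * |t| ^ (1 / (s + 1))) := by
  obtain ⟨K₁, hK₁, h₁⟩ := exists_logSum_add_le hp hs
  obtain ⟨K₂, hK₂, h₂⟩ : ∃ K₂ : ℝ, 0 ≤ K₂ ∧ (p < 1 / 2 → ∀ t : ℝ, 0 ≤ t →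
      -(logSum p s t + coeffC p s * t ^ (1 / s)) ≤ K₂ * t ^ (1 / (s + 1))) := by
    by_cases hp2 : p < 1 / 2
    · obtain ⟨K₂, hK₂, h₂⟩ := exists_neg_logSum_add_le hp hs hp2
      exact ⟨K₂, hK₂, fun _ => h₂⟩
    · exact ⟨0, le_rfl, fun h => absurd h hp2⟩
  -- F is forced by the factorization; the extra 1 makes K strictly positive.
  refine ⟨fun u => Cl p s u * Real.exp (coeffC p s * u ^ (1 / s)), K₁ + K₂ + 1, by positivity,
    fun t => ?_, fun t => ?_, fun hp2 t => ?_⟩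
  · beta_reduce
    rw [Cl_abs, mul_left_comm, ← Real.exp_add, neg_mul, neg_add_cancel, Real.exp_zero, mul_one]
  · have hpow : 0 ≤ |t| ^ (1 / (s + 1)) := by positivity
    rw [abs_mul, Real.abs_exp]
    -- A vanishing factor makes the product 0 and the bound trivial; otherwise the logarithm is
    -- available.
    by_cases hz : ∃ n : ℕ, factor p s |t| (n + 1) = 0
    · rw [Cl, tprod_of_exists_eq_zero hz, abs_zero, zero_mul]
      positivity
    · push Not at hz
      rw [abs_Cl_eq_exp_logSum hp hs hz, ← Real.exp_add]
      refine Real.exp_le_exp.2 ((h₁ _ (abs_nonneg t) hz).trans ?_)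
      gcongr
      linarith
  · have hpow : 0 ≤ |t| ^ (1 / (s + 1)) := by positivity
    beta_reduce
    rw [Cl_eq_exp_logSum hp hs hp2, ← Real.exp_add, Real.log_exp]
    refine ⟨Real.exp_pos _, abs_le'.2 ⟨?_, ?_⟩⟩
    · refine (h₁ _ (abs_nonneg t) fun n => (factor_pos hp hp2 s _ (n + 1)).ne').trans ?_
      gcongr
      linarith
    · refine (h₂ hp2 _ (abs_nonneg t)).trans ?_
      gcongr
      linarith

end RandomZeta

theorem theorem1 (p s : ℝ) (hp : p ∈ Set.Ioc (0 : ℝ) 1) (hs : 1 / 2 < s) :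
    -- the product and the integral that defines `C_{p;s}` converge
    (∀ t : ℝ, Multipliable (fun n : ℕ => RandomZeta.factor p s t (n + 1))) ∧
    IntegrableOn (RandomZeta.integrandC p s) (Set.Ioi 0) ∧
    -- factorization into trend and fluctuation, with the bounds on the latter
    (∃ F : ℝ → ℝ, ∃ K : ℝ, 0 < K ∧
      (∀ t : ℝ, RandomZeta.Cl p s t =
        Real.exp (-RandomZeta.coeffC p s * |t| ^ (1 / s)) * F |t|) ∧
      (∀ t : ℝ, |F (|t|)| ≤ Real.exp (K * |t| ^ (1 / (s + 1)))) ∧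
      (p < 1 / 2 → ∀ t : ℝ, 0 < F |t| ∧
        |Real.log (F |t|)| ≤ K * |t| ^ (1 / (s + 1)))) ∧
    -- the improper integral `A_s` converges, and its value
    (∀ R : ℝ, 0 ≤ R → IntervalIntegrable (RandomZeta.integrandA s) volume 0 R) ∧
    Tendsto (fun R : ℝ => ∫ ξ in (0 : ℝ)..R, RandomZeta.integrandA s ξ) atTop
      (𝓝 (RandomZeta.coeffA s)) ∧
    (s ≠ 1 → RandomZeta.coeffA s =
      Real.Gamma (1 - 1 / s) * Real.cos (Real.pi / (2 * s))) ∧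
    (s = 1 → RandomZeta.coeffA s = Real.pi / 2 ∧
      Tendsto (fun r : ℝ => Real.Gamma (1 - 1 / r) * Real.cos (Real.pi / (2 * r)))
        (𝓝[≠] 1) (𝓝 (RandomZeta.coeffA s))) ∧
    -- the series `B_{p;s}` converges, and the evaluation of `C_{p;s}`
    (p < 1 / 2 → Summable (RandomZeta.termB p s) ∧
      RandomZeta.coeffC p s = RandomZeta.coeffA s * RandomZeta.coeffB p s) := by
  refine ⟨RandomZeta.multipliable_factor hp hs, RandomZeta.integrableOn_integrandC hp hs,
    RandomZeta.exists_fluctuation hp hs, fun R => RandomZeta.intervalIntegrable_integrandA hs, ?_,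
    RandomZeta.coeffA_eq_gamma hs, ?_,
    fun hp2 => RandomZeta.coeffC_eq_coeffA_mul_coeffB hp.1 hp2 hs⟩
  · rw [RandomZeta.coeffA_eq hs]
    exact RandomZeta.tendsto_integral_integrandA hs
  · rintro rfl
    exact ⟨RandomZeta.coeffA_one, RandomZeta.tendsto_gamma_mul_cos⟩
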